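/- Let $d, s, N, m$ be natural numbers with $d, N \ge 1$, let $\sigma, M > 0$, $0 < t < 1$ and $0 < \rho \le 1$, and let $S_1,\dots,S_N$ be $s$-dimensional linear subspaces of $\mathbb{R}^d$. Let $\mathfrak{S} = \bigcup_{i=1}^N (S_i \cap B_M)$ with $B_M = \{x \in \mathbb{R}^d : \|x\|_2 \le M\}$, and let $$d_E(x,x') = \sqrt{2\left(1 - \exp\left(-\tfrac{\|x-x'\|_2^2}{2\sigma^2}\right)\right)}$$ be the kernel metric of the Gaussian kernel with bandwidth $\sigma$. Put $\gamma_\ell = \mathbb{E}_{\omega\sim\mathcal{N}(0,\sigma^{-2}I)} \|\omega\|_2^{\ell}$, let $f \ge 0$ be the function on $\mathbb{R}^d$ with $f(\omega)^2 = \frac13 \sum_{\ell=0}^{2} \|\omega\|_2^{2\ell}/\gamma_{2\ell}$, draw $\omega_1,\dots,\omega_m$ i.i.d. from the probability distribution $\Lambda = f(\omega)^2\,\mathcal{N}(0,\sigma^{-2}I)$, and let $\Psi : \mathbb{R}^d \to \mathbb{C}^m$ be the random map $$\Psi(x) = \frac{1}{\sqrt m}\left(\frac{e^{\mathrm{i}\,\omega_j^\top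 x}}{f(\omega_j)}\right)_{j=1}^m .$$ There is an absolute constant $C > 0$ (independent of all the quantities above) such that, whenever $$m \ge C\, t^{-2}\left(s \log\max\left(2, \tfrac{Md}{\sigma t}\right) + \log N + \log\tfrac1\rho\right),$$ the following two properties hold. 1. (Non-uniform lower restricted isometry property with constant $(1-t)^{-1}$, metric $d_E$, probability $1-\rho$ and error $0$.) For every $x \in \mathfrak{S}$, $$\mathbb{P}_\Psi\left[\forall x' \in \mathfrak{S},\ d_E(x,x') \le (1-t)^{-1}\|\Psi(x)-\Psi(x')\|_2\right] \ge 1-\rho .$$ 2. (Boundedness property with constant $\beta = 1+t$, metric $d_E$ and probability $1-\rho$.) For every $x \in \mathbb{R}^d$ and every $x_{\mathfrak{S}} \in \mathfrak{S}$, $$\mathbb{P}_\Psi\left[\|\Psi(x)-\Psi(x_{\mathfrak{S}})\|_2 \le (1+t)\, d_E(x,x_{\mathfrak{S}})\right] \ge 1-\rho .$$ -/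

import Mathlib

open MeasureTheory ProbabilityTheory

/-- The non-uniform lower restricted isometry property of a random operator `Ψ : E → F`, seen as
a family `Ψ w` indexed by the outcome `w` drawn from `P`, for the model `𝔖`, with constant `α`,
pseudometric `dE`, probability `1 - ρ` and error `η`. -/
def NonUniformLRIP {Ω E F : Type*} [MeasurableSpace Ω] [SeminormedAddCommGroup F]
    (P : Measure Ω) (Ψ : Ω → E → F) (𝔖 : Set E) (α : ℝ) (dE : E → E → ℝ) (ρ η : ℝ) : Prop :=
  ∀ x ∈ 𝔖, ENNReal.ofReal (1 - ρ) ≤ P {w | ∀ x' ∈ 𝔖, dE x x' ≤ α * ‖Ψ w x - Ψ w x'‖ + η}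

/-- The boundedness property of a random operator `Ψ : E → F` for the model `𝔖`, with constant
`β`, pseudometric `dG` and probability `1 - ρ`. -/
def BoundednessProperty {Ω E F : Type*} [MeasurableSpace Ω] [SeminormedAddCommGroup F]
    (P : Measure Ω) (Ψ : Ω → E → F) (𝔖 : Set E) (β : ℝ) (dG : E → E → ℝ) (ρ : ℝ) : Prop :=
  ∀ x, ∀ xS ∈ 𝔖, ENNReal.ofReal (1 - ρ) ≤ P {w | ‖Ψ w x - Ψ w xS‖ ≤ β * dG x xS}

/-- The model: the union of the subspaces `S i`, each intersected with the Euclidean ball of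
radius `M` around the origin. -/
def unionOfSubspaces {d N : ℕ} (S : Fin N → Submodule ℝ (EuclideanSpace ℝ (Fin d))) (M : ℝ) :
    Set (EuclideanSpace ℝ (Fin d)) :=
  ⋃ i, ((S i : Set (EuclideanSpace ℝ (Fin d))) ∩ Metric.closedBall 0 M)

noncomputable section

/-- The kernel metric of the Gaussian kernel `k(x, x') = exp (-‖x - x'‖² / (2σ²))`, that is,
`√(k(x, x) + k(x', x') - 2 k(x, x'))`. -/
def gaussianKernelMetric {d : ℕ} (σ : ℝ) (x x' : EuclideanSpace ℝ (Fin d)) : ℝ :=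
  Real.sqrt (2 * (1 - Real.exp (-(‖x - x'‖ ^ 2 / (2 * σ ^ 2)))))

/-- The Gaussian distribution `𝒩(0, σ⁻² I)` on `ℝ^d`. -/
def freqGaussian (d : ℕ) (σ : ℝ) : Measure (EuclideanSpace ℝ (Fin d)) :=
  multivariateGaussian 0 ((σ ^ 2)⁻¹ • (1 : Matrix (Fin d) (Fin d) ℝ))

/-- The moment `γ_ℓ = 𝔼 ‖ω‖^ℓ` for `ω ∼ 𝒩(0, σ⁻² I)`. -/
def freqMoment (d : ℕ) (σ : ℝ) (l : ℕ) : ℝ :=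
  ∫ ω, ‖ω‖ ^ l ∂(freqGaussian d σ)

/-- The weight `f`, the nonnegative function with
`f(ω)² = (1/3) ∑_{ℓ = 0, 1, 2} ‖ω‖^{2ℓ} / γ_{2ℓ}`. -/
def freqWeight {d : ℕ} (σ : ℝ) (ω : EuclideanSpace ℝ (Fin d)) : ℝ :=
  Real.sqrt ((1 / 3) * ∑ l ∈ Finset.range 3, ‖ω‖ ^ (2 * l) / freqMoment d σ (2 * l))

/-- The distribution `Λ = f(ω)² 𝒩(0, σ⁻² I)` of one frequency. -/
def freqMeasure (d : ℕ) (σ : ℝ) : Measure (EuclideanSpace ℝ (Fin d)) :=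
  (freqGaussian d σ).withDensity fun ω => ENNReal.ofReal (freqWeight σ ω ^ 2)

/-- The law of `m` frequencies drawn independently from `Λ`. -/
def freqLaw (d m : ℕ) (σ : ℝ) : Measure (Fin m → EuclideanSpace ℝ (Fin d)) :=
  Measure.pi fun _ => freqMeasure d σ

/-- The reweighted random Fourier feature `φ_ω(x) = exp(i ωᵀx) / f(ω)`. -/
def fourierFeature {d : ℕ} (σ : ℝ) (ω x : EuclideanSpace ℝ (Fin d)) : ℂ :=
  Complex.exp (Complex.I * ((inner ℝ ω x : ℝ) : ℂ)) / ((freqWeight σ ω : ℝ) : ℂ)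

/-- The random map `Ψ(x) = m^{-1/2} (φ_{ω_j}(x))_{j = 1, …, m}` with values in `ℂ^m`. -/
def randomFourierMap {d m : ℕ} (σ : ℝ) (ω : Fin m → EuclideanSpace ℝ (Fin d))
    (x : EuclideanSpace ℝ (Fin d)) : EuclideanSpace ℂ (Fin m) :=
  WithLp.toLp 2 fun j => ((1 / Real.sqrt m : ℝ) : ℂ) * fourierFeature σ (ω j) x

end

/-!
For a difference `u = x - x'`, the squared feature distance `‖Ψ x - Ψ x'‖²` is the empirical mean
of `2 (1 - cos ⟨ω_j, u⟩) / f(ω_j)²`, whose expectation is the squared kernel metric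
`h(u) = 2 (1 - exp (-‖u‖² / (2σ²)))`. Since `0 < t < 1`, both properties follow if this mean is at
most `(1 + t) h(u)`, respectively at least `(1 - t) h(u)`.

*Concentration.* Divided by `h(u)`, a summand before reweighting is at most `Z² + 2` with `Z`
standard normal (`two_mul_one_sub_cos_div_le`). As `f² ≥ 1/3`, the density `f²` and the weight `f⁻²`
together cost only constants in the exponential moments
(`integral_exp_div_freqWeight_sq_le`), so the means obey dimension-free tail bounds
`exp (-c m τ²)`, without a prefactor. This gives the boundedness property at once.

*Uniformity.* For fixed `x`, the differences `x - x'` lie in the `N` subspaces spanned by `S i` and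
`x`, inside the ball of radius `2 M`. The target `log (M d / (σ t))` in place of `log (d / t)`
requires two regimes, separated at `‖u‖² = σ² t^{3/2} / (400 d)`.

* Below the threshold, `2 (1 - cos z) ≥ z² - z⁴`. After discarding the frequencies with
  `σ² ‖ω‖² / d > 100 / √t`, which costs `O(t)` of the second moment, the quartic term is at most
  `t / 4` times the quadratic one, and what remains is a quadratic form in `u`. It is controlled on
  the unit sphere by a `1 / 4`-net, of cardinality `9 ^ dim`, independent of `M`, `d` and `t`
  (`LinearMap.BilinForm.abs_le_of_net`).
* Above the threshold, an `ε`-net with `ε` polynomial in `σ`, `t` and `d⁻¹` suffices, because the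
  weight makes the empirical metric Lipschitz with the deterministic constant `3 √d / σ`
  (`sqKernelMetric_le_of_near`). This regime is empty unless `M` is large enough that `d / t` is
  bounded by a power of `M d / (σ t)`, and then so is the base of the covering number
  (`one_add_div_le_pow`).

`exists_exceptional_set` combines the two regimes on one subspace, and `card_mul_exp_le` carries out
the union bound.
-/

/-! ### Nets in finite-dimensional spaces -/

open Module in
/-- Volume bound for separated sets: disjoint balls of radius `ε / 2` around the points lie in a
ball of radius `R + ε / 2`. -/
theorem card_le_of_norm_le_of_separated {E : Type*} [NormedAddCommGroup E] [NormedSpace ℝ E]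
    [FiniteDimensional ℝ E] {R ε : ℝ} (hR : 0 ≤ R) (hε : 0 < ε) (s : Finset E)
    (hs : ∀ c ∈ s, ‖c‖ ≤ R) (h : ∀ c ∈ s, ∀ d ∈ s, c ≠ d → ε ≤ ‖c - d‖) :
    (s.card : ℝ) ≤ (1 + 2 * R / ε) ^ finrank ℝ E := by
  borelize E
  let μ : Measure E := Measure.addHaar
  have hδ : 0 < ε / 2 := by positivity
  have hρ : 0 < R + ε / 2 := by positivity
  have hdisj : Set.Pairwise (s : Set E)
      (Function.onFun Disjoint fun c => Metric.ball c (ε / 2)) := by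
    rintro c hc d hd hcd
    apply Metric.ball_disjoint_ball
    rw [dist_eq_norm]
    linarith [h c hc d hd hcd]
  have hsub : (⋃ c ∈ s, Metric.ball c (ε / 2)) ⊆ Metric.ball (0 : E) (R + ε / 2) := by
    refine Set.iUnion₂_subset fun x hx => Metric.ball_subset_ball' ?_
    rw [dist_zero_right]
    linarith [hs x hx]
  have hvol : (s.card : ENNReal) * ENNReal.ofReal ((ε / 2) ^ finrank ℝ E) * μ (Metric.ball 0 1) ≤
      ENNReal.ofReal ((R + ε / 2) ^ finrank ℝ E) * μ (Metric.ball 0 1) :=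
    calc
      _ = μ (⋃ c ∈ s, Metric.ball c (ε / 2)) := by
        rw [measure_biUnion_finset hdisj fun c _ => measurableSet_ball]
        simp only [μ.addHaar_ball_of_pos _ hδ, Finset.sum_const, nsmul_eq_mul, mul_assoc]
      _ ≤ μ (Metric.ball (0 : E) (R + ε / 2)) := measure_mono hsub
      _ = _ := by simp only [μ.addHaar_ball_of_pos _ hρ]
  have hle : (s.card : ENNReal) * ENNReal.ofReal ((ε / 2) ^ finrank ℝ E) ≤
      ENNReal.ofReal ((R + ε / 2) ^ finrank ℝ E) :=
    (ENNReal.mul_le_mul_iff_left (Metric.measure_ball_pos _ _ zero_lt_one).ne'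
      measure_ball_lt_top.ne).1 hvol
  have hreal := ENNReal.toReal_le_of_le_ofReal (by positivity) hle
  rw [ENNReal.toReal_mul, ENNReal.toReal_natCast, ENNReal.toReal_ofReal (by positivity)] at hreal
  calc (s.card : ℝ) ≤ (R + ε / 2) ^ finrank ℝ E / (ε / 2) ^ finrank ℝ E := by
        rwa [le_div_iff₀ (by positivity)]
    _ = (1 + 2 * R / ε) ^ finrank ℝ E := by
        rw [← div_pow]
        congr 1
        field_simp
        ring

open Module in
/-- A bounded subset `A` of a finite-dimensional space has an `ε`-net made of points of `A`, of
the cardinality given by the volume bound. -/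
theorem exists_finset_net {E : Type*} [NormedAddCommGroup E] [NormedSpace ℝ E]
    [FiniteDimensional ℝ E] {R ε : ℝ} (hR : 0 ≤ R) (hε : 0 < ε) (A : Set E)
    (hA : ∀ a ∈ A, ‖a‖ ≤ R) :
    ∃ F : Finset E, (∀ n ∈ F, n ∈ A) ∧ (∀ a ∈ A, ∃ n ∈ F, ‖a - n‖ ≤ ε) ∧
      (F.card : ℝ) ≤ (1 + 2 * R / ε) ^ finrank ℝ E := by
  classical
  let P : ℕ → Prop := fun k => ∃ F : Finset E, (∀ n ∈ F, n ∈ A) ∧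
    (∀ c ∈ F, ∀ d ∈ F, c ≠ d → ε ≤ ‖c - d‖) ∧ F.card = k
  have hP0 : P 0 := ⟨∅, by simp⟩
  have hbdd : ∀ k, P k → k ≤ ⌊(1 + 2 * R / ε) ^ finrank ℝ E⌋₊ := by
    rintro k ⟨F, hFA, hsep, rfl⟩
    exact Nat.le_floor
      (card_le_of_norm_le_of_separated hR hε F (fun c hc => hA c (hFA c hc)) hsep)
  -- A separated subset of maximal cardinality is a net.
  obtain ⟨F, hFA, hsep, hcard⟩ := Nat.findGreatest_spec (P := P)
    (n := ⌊(1 + 2 * R / ε) ^ finrank ℝ E⌋₊) (Nat.zero_le _) hP0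
  refine ⟨F, hFA, fun a ha => ?_,
    card_le_of_norm_le_of_separated hR hε F (fun c hc => hA c (hFA c hc)) hsep⟩
  by_contra! hfar
  have haF : a ∉ F := fun haF => by
    have := hfar a haF
    simp only [sub_self, norm_zero] at this
    linarith
  have hP : P (F.card + 1) := by
    refine ⟨insert a F, ?_, ?_, Finset.card_insert_of_notMem haF⟩
    · intro n hn
      rcases Finset.mem_insert.1 hn with rfl | hn
      exacts [ha, hFA n hn]
    · intro c hc d hd hcd
      rcases Finset.mem_insert.1 hc with hca | hcF <;>
        rcases Finset.mem_insert.1 hd with hda | hdF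
      · exact absurd (hca.trans hda.symm) hcd
      · rw [hca]; exact (hfar d hdF).le
      · rw [hda, norm_sub_rev]; exact (hfar c hcF).le
      · exact hsep c hcF d hdF hcd
  have := Nat.le_findGreatest (hbdd _ hP) hP
  rw [← hcard] at this
  exact absurd this (Nat.not_succ_le_self _)

open Module in
/-- The net of `exists_finset_net` for a subset of a subspace `T`, with the dimension of `T` in the
exponent. -/
theorem Submodule.exists_finset_net {E : Type*} [NormedAddCommGroup E] [NormedSpace ℝ E]
    [FiniteDimensional ℝ E] (T : Submodule ℝ E) {R ε : ℝ} (hR : 0 ≤ R) (hε : 0 < ε)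
    (A : Set E) (hAT : ∀ a ∈ A, a ∈ T) (hA : ∀ a ∈ A, ‖a‖ ≤ R) :
    ∃ F : Finset E, (∀ n ∈ F, n ∈ A) ∧ (∀ a ∈ A, ∃ n ∈ F, ‖a - n‖ ≤ ε) ∧
      (F.card : ℝ) ≤ (1 + 2 * R / ε) ^ finrank ℝ T := by
  obtain ⟨F, h1, h2, h3⟩ := _root_.exists_finset_net hR hε (E := T) {a | (a : E) ∈ A}
    (fun a ha => hA a ha)
  refine ⟨F.map (Function.Embedding.subtype _), ?_, ?_, by simpa using h3⟩
  · simp only [Finset.mem_map]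
    rintro n ⟨a, ha, rfl⟩
    exact h1 a ha
  · intro a ha
    obtain ⟨n, hn, hle⟩ := h2 ⟨a, hAT a ha⟩ ha
    exact ⟨n, Finset.mem_map.2 ⟨n, hn, rfl⟩, hle⟩

/-! ### Quadratic forms on nets -/

/-- Polarization estimate: a symmetric form whose diagonal is at most `S` on the unit sphere moves
by at most `S / 2` between unit vectors at distance at most `1 / 4`. -/
theorem LinearMap.BilinForm.abs_sub_le_of_norm_sub_le {E : Type*} [NormedAddCommGroup E]
    [InnerProductSpace ℝ E] (B : LinearMap.BilinForm ℝ E) (hB : ∀ a b, B a b = B b a)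
    (T : Submodule ℝ E) {S : ℝ} (hS : ∀ v ∈ T, |B v v| ≤ S * ‖v‖ ^ 2) {v n : E}
    (hv : v ∈ T) (hn : n ∈ T) (hv1 : ‖v‖ = 1) (hn1 : ‖n‖ = 1) (hvn : ‖v - n‖ ≤ 1 / 4) :
    |B v v - B n n| ≤ S / 2 := by
  have hS0 : 0 ≤ S := by
    have := (abs_nonneg _).trans (hS v hv)
    rwa [hv1, one_pow, mul_one] at this
  -- Weights `2√2` and `1 / (2√2)` balance `‖v - n‖ ≤ 1 / 4` against `‖v + n‖ ≤ 2`.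
  set c : ℝ := 2 * Real.sqrt 2 with hc
  have hc2 : c ^ 2 = 8 := by
    rw [hc, mul_pow, Real.sq_sqrt (by norm_num)]; norm_num
  have hc0 : c ≠ 0 := by positivity
  set a := c • (v - n)
  set b := c⁻¹ • (v + n)
  have ha : a ∈ T := T.smul_mem _ (T.sub_mem hv hn)
  have hb : b ∈ T := T.smul_mem _ (T.add_mem hv hn)
  have hpol : B v v - B n n = (B (a + b) (a + b) - B (a - b) (a - b)) / 4 := by
    have hab : B a b = B v v - B n n := by
      simp only [a, b, map_smul, LinearMap.smul_apply, map_sub, map_add, LinearMap.sub_apply,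
        smul_eq_mul, hB n v]
      field_simp
      ring
    rw [← hab]
    simp only [map_sub, map_add, LinearMap.sub_apply, LinearMap.add_apply, hB b a]
    ring
  have hpar : ‖a + b‖ ^ 2 + ‖a - b‖ ^ 2 = 2 * (‖a‖ ^ 2 + ‖b‖ ^ 2) := by
    have := parallelogram_law_with_norm ℝ a b
    nlinarith
  have hna : ‖a‖ ^ 2 ≤ 1 / 2 := by
    rw [norm_smul, mul_pow, Real.norm_eq_abs, sq_abs, hc2]
    nlinarith [norm_nonneg (v - n)]
  have hnb : ‖b‖ ^ 2 ≤ 1 / 2 := by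
    have h2 : ‖v + n‖ ≤ 2 := (norm_add_le _ _).trans (by rw [hv1, hn1]; norm_num)
    rw [norm_smul, mul_pow, Real.norm_eq_abs, sq_abs, inv_pow, hc2]
    nlinarith [norm_nonneg (v + n)]
  have h1 := abs_le.1 (hS _ (T.add_mem ha hb))
  have h2 := abs_le.1 (hS _ (T.sub_mem ha hb))
  have h3 : S * ‖a + b‖ ^ 2 + S * ‖a - b‖ ^ 2 ≤ 2 * S := by
    rw [← mul_add, hpar]
    nlinarith
  rw [hpol, abs_le]
  constructor <;> linarith [h1.1, h1.2, h2.1, h2.2]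

/-- A symmetric form that is at most `η` on a `1 / 4`-net of the unit sphere of `T` is at most
`2 * η` on the whole sphere. -/
theorem LinearMap.BilinForm.abs_le_of_net {E : Type*} [NormedAddCommGroup E]
    [InnerProductSpace ℝ E] [FiniteDimensional ℝ E] (B : LinearMap.BilinForm ℝ E)
    (hB : ∀ a b, B a b = B b a) (T : Submodule ℝ E) {η : ℝ} (F : Finset E)
    (hFT : ∀ n ∈ F, n ∈ T) (hF1 : ∀ n ∈ F, ‖n‖ = 1)
    (hnet : ∀ v ∈ T, ‖v‖ = 1 → ∃ n ∈ F, ‖v - n‖ ≤ 1 / 4) (hη : ∀ n ∈ F, |B n n| ≤ η)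
    {v : E} (hv : v ∈ T) (hv1 : ‖v‖ = 1) : |B v v| ≤ 2 * η := by
  set A : Set ℝ := {r | ∃ v ∈ T, ‖v‖ = 1 ∧ |B v v| = r}
  have hne : A.Nonempty := ⟨_, v, hv, hv1, rfl⟩
  have hbdd : BddAbove A := by
    refine ⟨‖LinearMap.toContinuousBilinearMap B‖, ?_⟩
    rintro _ ⟨w, -, hw1, rfl⟩
    simpa [hw1] using (LinearMap.toContinuousBilinearMap B).le_opNorm₂ w w
  have hS : ∀ w ∈ T, |B w w| ≤ sSup A * ‖w‖ ^ 2 := by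
    intro w hw
    by_cases h0 : w = 0
    · simp [h0]
    have hw0 : ‖w‖ ≠ 0 := norm_ne_zero_iff.2 h0
    have := le_csSup hbdd
      (⟨‖w‖⁻¹ • w, T.smul_mem _ hw, by rw [norm_smul, norm_inv, norm_norm, inv_mul_cancel₀ hw0],
        rfl⟩ : |B (‖w‖⁻¹ • w) (‖w‖⁻¹ • w)| ∈ A)
    simp only [map_smul, LinearMap.smul_apply, smul_eq_mul, abs_mul, abs_inv, abs_norm] at this
    field_simp at this
    linarith
  have hle : sSup A ≤ η + sSup A / 2 := by
    refine csSup_le hne ?_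
    rintro _ ⟨w, hw, hw1, rfl⟩
    obtain ⟨n, hn, hwn⟩ := hnet w hw hw1
    have h1 := B.abs_sub_le_of_norm_sub_le hB T hS hw (hFT n hn) hw1 (hF1 n hn) hwn
    have h2 := abs_sub_abs_le_abs_sub (B w w) (B n n)
    linarith [hη n hn]
  have := le_csSup hbdd (⟨v, hv, hv1, rfl⟩ : |B v v| ∈ A)
  linarith

/-! ### Scalar inequalities -/

theorem sq_sub_pow_four_le_two_mul_one_sub_cos (z : ℝ) :
    z ^ 2 - z ^ 4 ≤ 2 * (1 - Real.cos z) := by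
  rcases le_or_gt |z| 1 with h | h
  · have h1 := (abs_le.1 (Real.cos_bound h)).2
    have h2 : |z| ^ 4 = z ^ 4 := by rw [← abs_pow, abs_of_nonneg (by positivity)]
    rw [h2] at h1
    nlinarith [sq_nonneg (z ^ 2)]
  · have h1 : 1 ≤ z ^ 2 := by
      rw [← sq_abs]; nlinarith
    nlinarith [Real.cos_le_one z]

theorem abs_exp_sub_one_sub_le (x : ℝ) :
    |Real.exp x - 1 - x| ≤ x ^ 2 * Real.exp |x| := by
  have := Complex.norm_exp_sub_sum_le_norm_mul_exp (x : ℂ) 2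
  simp only [Finset.sum_range_succ, Finset.sum_range_zero] at this
  norm_num at this
  rw [← Complex.ofReal_exp] at this
  rw [show ((Real.exp x : ℝ) : ℂ) - (1 + (x : ℂ)) = ((Real.exp x - 1 - x : ℝ) : ℂ) by
    push_cast; ring, Complex.norm_real, Real.norm_eq_abs] at this
  exact this

/-- `1 - exp (-y)` dominates the rational function `y / (1 + y)`. -/
theorem div_one_add_le_one_sub_exp_neg {y : ℝ} (hy : 0 ≤ y) :
    y / (1 + y) ≤ 1 - Real.exp (-y) := by
  have h1 : Real.exp (-y) ≤ 1 / (1 + y) := by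
    rw [Real.exp_neg, ← one_div]
    exact one_div_le_one_div_of_le (by positivity) (by linarith [Real.add_one_le_exp y])
  have h2 : y / (1 + y) = 1 - 1 / (1 + y) := by field_simp; ring
  linarith

/-! ### The Gaussian frequency distribution -/

instance isProbabilityMeasure_freqGaussian (d : ℕ) (σ : ℝ) :
    IsProbabilityMeasure (freqGaussian d σ) := by
  unfold freqGaussian; infer_instance

theorem charFun_freqGaussian {d : ℕ} (σ : ℝ) (u : EuclideanSpace ℝ (Fin d)) :
    charFun (freqGaussian d σ) u = Complex.exp (-((‖u‖ ^ 2 / (2 * σ ^ 2) : ℝ) : ℂ)) := by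
  have hS : ((σ ^ 2)⁻¹ • (1 : Matrix (Fin d) (Fin d) ℝ)).PosSemidef :=
    Matrix.PosSemidef.one.smul (by positivity)
  have hdot : u.ofLp ⬝ᵥ ((σ ^ 2)⁻¹ • (1 : Matrix (Fin d) (Fin d) ℝ)).mulVec u.ofLp
      = (σ ^ 2)⁻¹ * ‖u‖ ^ 2 := by
    rw [Matrix.smul_mulVec, Matrix.one_mulVec, dotProduct_smul, EuclideanSpace.real_norm_sq_eq,
      smul_eq_mul]
    simp [dotProduct, sq]
  rw [freqGaussian, charFun_multivariateGaussian hS]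
  simp only [inner_zero_right, Complex.ofReal_zero, zero_mul, zero_sub]
  rw [hdot]
  congr 1
  push_cast
  field_simp

/-- Projected to a direction of norm `σ`, the frequencies are standard normal. -/
theorem map_inner_freqGaussian {d : ℕ} {σ : ℝ} (hσ : 0 < σ) {v : EuclideanSpace ℝ (Fin d)}
    (hv : ‖v‖ = σ) :
    (freqGaussian d σ).map (fun ω => inner ℝ ω v) = gaussianReal 0 1 := by
  have : IsProbabilityMeasure ((freqGaussian d σ).map (fun ω => inner ℝ ω v)) :=
    Measure.isProbabilityMeasure_map (by fun_prop)
  refine Measure.ext_of_charFun (funext fun r => ?_)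
  have h := charFun_freqGaussian σ (r • v)
  rw [charFun_apply] at h
  rw [charFun_apply_real, charFun_gaussianReal, integral_map (by fun_prop) (by fun_prop)]
  simp only [inner_smul_right, Complex.ofReal_mul, norm_smul, hv] at h
  rw [h]
  congr 1
  have : (σ : ℂ) ≠ 0 := by exact_mod_cast hσ.ne'
  simp only [mul_pow, Real.norm_eq_abs, sq_abs]
  push_cast
  field_simp
  simp [sq]

theorem integral_cos_inner_freqGaussian {d : ℕ} (σ : ℝ) (u : EuclideanSpace ℝ (Fin d)) :
    ∫ ω, Real.cos (inner ℝ ω u) ∂(freqGaussian d σ) = Real.exp (-(‖u‖ ^ 2 / (2 * σ ^ 2))) := by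
  have h := congrArg Complex.re (charFun_freqGaussian σ u)
  rw [← Complex.ofReal_neg, ← Complex.ofReal_exp, Complex.ofReal_re, charFun_apply] at h
  rw [← h, ← RCLike.re_eq_complex_re, ← integral_re]
  · refine integral_congr_ae (.of_forall fun ω => ?_)
    simp [Complex.exp_ofReal_mul_I_re]
  · refine Integrable.mono' (integrable_const (1 : ℝ)) (by fun_prop) (.of_forall fun ω => ?_)
    rw [Complex.norm_exp_ofReal_mul_I]

theorem gaussianPDFReal_mul_exp_sq_div_four (z : ℝ) :
    gaussianPDFReal 0 1 z * Real.exp (z ^ 2 / 4) =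
      (Real.sqrt (2 * Real.pi))⁻¹ * Real.exp (-(1 / 4) * z ^ 2) := by
  rw [gaussianPDFReal, mul_assoc, ← Real.exp_add]
  norm_num
  ring_nf
  simp

theorem integrable_exp_sq_div_four_gaussianReal :
    Integrable (fun z : ℝ => Real.exp (z ^ 2 / 4)) (gaussianReal 0 1) := by
  rw [gaussianReal_of_var_ne_zero 0 one_ne_zero,
    integrable_withDensity_iff_integrable_smul' (measurable_gaussianPDF _ _)
      (.of_forall fun _ => gaussianPDF_lt_top)]
  simp only [toReal_gaussianPDF, smul_eq_mul, gaussianPDFReal_mul_exp_sq_div_four]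
  exact (integrable_exp_neg_mul_sq (by norm_num)).const_mul _

theorem integral_exp_sq_div_four_gaussianReal :
    ∫ z, Real.exp (z ^ 2 / 4) ∂(gaussianReal 0 1) = Real.sqrt 2 := by
  rw [integral_gaussianReal_eq_integral_smul one_ne_zero]
  simp only [smul_eq_mul, gaussianPDFReal_mul_exp_sq_div_four]
  rw [integral_const_mul, integral_gaussian, ← Real.sqrt_inv, ← Real.sqrt_mul (by positivity)]
  congr 1
  field_simp
  norm_num

section Moments

variable {d : ℕ} {σ : ℝ}

theorem integrable_exp_inner_sq (hσ : 0 < σ) {v : EuclideanSpace ℝ (Fin d)} (hv : ‖v‖ = σ) :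
    Integrable (fun ω => Real.exp (inner ℝ ω v ^ 2 / 4)) (freqGaussian d σ) := by
  have h := integrable_exp_sq_div_four_gaussianReal
  rw [← map_inner_freqGaussian hσ hv, integrable_map_measure (by fun_prop) (by fun_prop)] at h
  exact h

theorem integral_exp_inner_sq (hσ : 0 < σ) {v : EuclideanSpace ℝ (Fin d)} (hv : ‖v‖ = σ) :
    ∫ ω, Real.exp (inner ℝ ω v ^ 2 / 4) ∂(freqGaussian d σ) = Real.sqrt 2 := by
  have h := integral_exp_sq_div_four_gaussianReal
  rw [← map_inner_freqGaussian hσ hv, integral_map (by fun_prop) (by fun_prop)] at h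
  exact h

theorem integral_inner_sq (hσ : 0 < σ) {v : EuclideanSpace ℝ (Fin d)} (hv : ‖v‖ = σ) :
    ∫ ω, inner ℝ ω v ^ 2 ∂(freqGaussian d σ) = 1 := by
  have h : ∫ z : ℝ, z ^ 2 ∂(gaussianReal 0 1) = 1 := by
    have h1 := variance_of_integral_eq_zero (μ := gaussianReal 0 1) (X := id)
      (by fun_prop) (by simp)
    rw [variance_id_gaussianReal] at h1
    simpa using h1.symm
  rw [← map_inner_freqGaussian hσ hv, integral_map (by fun_prop) (by fun_prop)] at h
  exact h

theorem integrable_inner_sq (hσ : 0 < σ) {v : EuclideanSpace ℝ (Fin d)} (hv : ‖v‖ = σ) :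
    Integrable (fun ω => inner ℝ ω v ^ 2) (freqGaussian d σ) := by
  refine ((integrable_exp_inner_sq hσ hv).const_mul 4).mono' (by fun_prop) (.of_forall fun ω => ?_)
  rw [Real.norm_of_nonneg (by positivity)]
  linarith [Real.add_one_le_exp (inner ℝ ω v ^ 2 / 4)]

/-- The normalized squared norm is the average of the squares of the projections to the
coordinate directions, scaled to norm `σ`. -/
theorem normSq_eq_sum_inner_sq (ω : EuclideanSpace ℝ (Fin d)) :
    σ ^ 2 * ‖ω‖ ^ 2 / d =
      ∑ i : Fin d, (1 / d : ℝ) * inner ℝ ω (EuclideanSpace.single i σ) ^ 2 := by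
  rw [EuclideanSpace.real_norm_sq_eq, Finset.mul_sum, Finset.sum_div]
  refine Finset.sum_congr rfl fun i _ => ?_
  simp [EuclideanSpace.inner_single_right]
  ring

theorem exp_normSq_le (hd : 1 ≤ d) (ω : EuclideanSpace ℝ (Fin d)) :
    Real.exp (σ ^ 2 * ‖ω‖ ^ 2 / d / 4) ≤
      ∑ i : Fin d, (1 / d : ℝ) * Real.exp (inner ℝ ω (EuclideanSpace.single i σ) ^ 2 / 4) := by
  have hd0 : (d : ℝ) ≠ 0 := by positivity
  have h := convexOn_exp.map_sum_le (t := Finset.univ) (w := fun _ : Fin d => (1 / d : ℝ))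
    (p := fun i => inner ℝ ω (EuclideanSpace.single i σ) ^ 2 / 4)
    (fun _ _ => by positivity) (by simp [hd0]) (fun _ _ => Set.mem_univ _)
  rw [normSq_eq_sum_inner_sq, Finset.sum_div]
  simpa [mul_div_assoc] using h

theorem norm_single_of_pos (hσ : 0 < σ) (i : Fin d) :
    ‖(EuclideanSpace.single i σ : EuclideanSpace ℝ (Fin d))‖ = σ := by
  simp [abs_of_pos hσ]

theorem integrable_exp_normSq (hσ : 0 < σ) (hd : 1 ≤ d) :
    Integrable (fun ω => Real.exp (σ ^ 2 * ‖ω‖ ^ 2 / d / 4)) (freqGaussian d σ) := by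
  refine Integrable.mono' (integrable_finsetSum Finset.univ fun i _ =>
    (integrable_exp_inner_sq hσ (norm_single_of_pos hσ i)).const_mul (1 / d : ℝ)) (by fun_prop)
    (.of_forall fun ω => ?_)
  rw [Real.norm_of_nonneg (by positivity)]
  exact exp_normSq_le hd ω

theorem integral_exp_normSq_le (hσ : 0 < σ) (hd : 1 ≤ d) :
    ∫ ω, Real.exp (σ ^ 2 * ‖ω‖ ^ 2 / d / 4) ∂(freqGaussian d σ) ≤ Real.sqrt 2 := by
  have hint : ∀ i ∈ Finset.univ, Integrable (fun ω => (1 / d : ℝ) *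
      Real.exp (inner ℝ ω (EuclideanSpace.single i σ) ^ 2 / 4)) (freqGaussian d σ) := fun i _ =>
    (integrable_exp_inner_sq hσ (norm_single_of_pos hσ i)).const_mul _
  refine (integral_mono (integrable_exp_normSq hσ hd) (integrable_finsetSum _ hint)
    (exp_normSq_le hd)).trans_eq ?_
  have hd0 : (d : ℝ) ≠ 0 := by positivity
  rw [integral_finsetSum _ hint]
  simp only [integral_const_mul, integral_exp_inner_sq hσ (norm_single_of_pos hσ _)]
  simp [hd0]

theorem integral_normSq (hσ : 0 < σ) (hd : 1 ≤ d) :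
    ∫ ω, σ ^ 2 * ‖ω‖ ^ 2 / d ∂(freqGaussian d σ) = 1 := by
  have hd0 : (d : ℝ) ≠ 0 := by positivity
  simp only [normSq_eq_sum_inner_sq]
  rw [integral_finsetSum _ fun i _ =>
    (integrable_inner_sq hσ (norm_single_of_pos hσ i)).const_mul _]
  simp only [integral_const_mul, integral_inner_sq hσ (norm_single_of_pos hσ _)]
  simp [hd0]

/-- All even moments of the norm are finite, by comparison with the exponential moment. -/
theorem integrable_norm_pow (hσ : 0 < σ) (hd : 1 ≤ d) (k : ℕ) :
    Integrable (fun ω : EuclideanSpace ℝ (Fin d) => ‖ω‖ ^ (2 * k)) (freqGaussian d σ) := by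
  refine ((integrable_exp_normSq hσ hd).const_mul ((4 * d / σ ^ 2) ^ k * k.factorial)).mono'
    (by fun_prop) (.of_forall fun ω => ?_)
  have hd0 : (0 : ℝ) < d := by positivity
  rw [Real.norm_of_nonneg (by positivity)]
  have h := Real.pow_div_factorial_le_exp (x := σ ^ 2 * ‖ω‖ ^ 2 / d / 4) (by positivity) k
  calc ‖ω‖ ^ (2 * k) = (4 * d / σ ^ 2) ^ k * k.factorial *
        ((σ ^ 2 * ‖ω‖ ^ 2 / d / 4) ^ k / k.factorial) := by
        have hf : (k.factorial : ℝ) ≠ 0 := by positivity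
        rw [mul_assoc, mul_div_cancel₀ _ hf, ← mul_pow, pow_mul]
        congr 1
        field_simp
    _ ≤ _ := by gcongr

theorem freqMoment_zero (d : ℕ) (σ : ℝ) : freqMoment d σ 0 = 1 := by
  simp [freqMoment]

theorem freqMoment_two (hσ : 0 < σ) (hd : 1 ≤ d) : freqMoment d σ 2 = d / σ ^ 2 := by
  have hd0 : (0 : ℝ) < d := by positivity
  have h := integral_normSq hσ hd
  simp only [mul_div_assoc, integral_const_mul, integral_div] at h
  rw [freqMoment]
  field_simp at h ⊢
  linarith

theorem freqMoment_pos (hσ : 0 < σ) (hd : 1 ≤ d) (l : ℕ) : 0 < freqMoment d σ (2 * l) := by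
  refine (integral_nonneg fun ω => by positivity).lt_of_ne' fun h0 => ?_
  rw [integral_eq_zero_iff_of_nonneg (fun ω => by positivity) (integrable_norm_pow hσ hd l)] at h0
  -- Otherwise the frequencies vanish almost surely, against the value of the second moment.
  have h2 : freqMoment d σ 2 = 0 := by
    refine integral_eq_zero_of_ae ?_
    filter_upwards [h0] with ω hω
    have : ‖ω‖ = 0 := eq_zero_of_pow_eq_zero hω
    simp [this]
  have hd0 : (0 : ℝ) < d := by positivity
  rw [freqMoment_two hσ hd] at h2
  have : (0 : ℝ) < d / σ ^ 2 := by positivity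
  linarith

end Moments

/-! ### The weight and the reweighted frequency distribution -/

section Weight

variable {d : ℕ} {σ : ℝ}

theorem freqWeight_sq (hσ : 0 < σ) (hd : 1 ≤ d) (ω : EuclideanSpace ℝ (Fin d)) :
    freqWeight σ ω ^ 2 =
      1 / 3 * (1 + σ ^ 2 * ‖ω‖ ^ 2 / d + ‖ω‖ ^ (2 * 2) / freqMoment d σ (2 * 2)) := by
  have h4 := freqMoment_pos hσ hd 2
  have h : ∑ l ∈ Finset.range 3, ‖ω‖ ^ (2 * l) / freqMoment d σ (2 * l) =
      1 + σ ^ 2 * ‖ω‖ ^ 2 / d + ‖ω‖ ^ (2 * 2) / freqMoment d σ (2 * 2) := by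
    simp only [Finset.sum_range_succ, Finset.sum_range_zero, mul_zero, mul_one, pow_zero,
      freqMoment_zero, freqMoment_two hσ hd]
    have hd0 : (d : ℝ) ≠ 0 := by positivity
    field_simp
    ring
  rw [freqWeight, h, Real.sq_sqrt (by positivity)]

theorem one_third_mul_le_freqWeight_sq (hσ : 0 < σ) (hd : 1 ≤ d)
    (ω : EuclideanSpace ℝ (Fin d)) :
    1 / 3 * (1 + σ ^ 2 * ‖ω‖ ^ 2 / d) ≤ freqWeight σ ω ^ 2 := by
  have h4 := freqMoment_pos hσ hd 2
  have : 0 ≤ ‖ω‖ ^ (2 * 2) / freqMoment d σ (2 * 2) := by positivity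
  rw [freqWeight_sq hσ hd]
  linarith

theorem one_third_le_freqWeight_sq (hσ : 0 < σ) (hd : 1 ≤ d) (ω : EuclideanSpace ℝ (Fin d)) :
    1 / 3 ≤ freqWeight σ ω ^ 2 := by
  have := one_third_mul_le_freqWeight_sq hσ hd ω
  have h : 0 ≤ σ ^ 2 * ‖ω‖ ^ 2 / d := by positivity
  linarith

theorem freqWeight_sq_pos (hσ : 0 < σ) (hd : 1 ≤ d) (ω : EuclideanSpace ℝ (Fin d)) :
    0 < freqWeight σ ω ^ 2 :=
  lt_of_lt_of_le (by norm_num) (one_third_le_freqWeight_sq hσ hd ω)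

/-- The weight grows fast enough to make the reweighted features Lipschitz. -/
theorem norm_le_freqWeight_sq (hσ : 0 < σ) (hd : 1 ≤ d) (ω : EuclideanSpace ℝ (Fin d)) :
    ‖ω‖ ≤ 3 / 2 * (Real.sqrt d / σ) * freqWeight σ ω ^ 2 := by
  have hd0 : (0 : ℝ) < d := by positivity
  have hs := Real.sq_sqrt hd0.le
  have hs0 := Real.sqrt_pos.2 hd0
  refine le_trans ?_ (mul_le_mul_of_nonneg_left (one_third_mul_le_freqWeight_sq hσ hd ω)
    (by positivity))
  set r := Real.sqrt d
  rw [← hs, show 3 / 2 * (r / σ) * (1 / 3 * (1 + σ ^ 2 * ‖ω‖ ^ 2 / r ^ 2)) =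
    (r ^ 2 + (σ * ‖ω‖) ^ 2) / (2 * r * σ) by field_simp, le_div_iff₀ (by positivity)]
  nlinarith [sq_nonneg (r - σ * ‖ω‖)]

theorem measurable_freqWeight : Measurable (freqWeight (d := d) σ) := by
  unfold freqWeight
  fun_prop

theorem integrable_freqWeight_sq (hσ : 0 < σ) (hd : 1 ≤ d) :
    Integrable (fun ω : EuclideanSpace ℝ (Fin d) => freqWeight σ ω ^ 2) (freqGaussian d σ) := by
  simp only [freqWeight_sq hσ hd, mul_div_assoc]
  exact (((integrable_const _).add
    (((integrable_norm_pow hσ hd 1).div_const _).const_mul _)).add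
    ((integrable_norm_pow hσ hd 2).div_const _)).const_mul _

theorem integral_freqWeight_sq (hσ : 0 < σ) (hd : 1 ≤ d) :
    ∫ ω : EuclideanSpace ℝ (Fin d), freqWeight σ ω ^ 2 ∂(freqGaussian d σ) = 1 := by
  have h2 := integral_normSq hσ hd
  have h4 : ∫ ω : EuclideanSpace ℝ (Fin d), ‖ω‖ ^ (2 * 2) / freqMoment d σ (2 * 2)
      ∂(freqGaussian d σ) = 1 := by
    rw [integral_div, ← freqMoment, div_self (freqMoment_pos hσ hd 2).ne']
  have i2 : Integrable (fun ω : EuclideanSpace ℝ (Fin d) => σ ^ 2 * ‖ω‖ ^ 2 / d)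
      (freqGaussian d σ) := ((integrable_norm_pow hσ hd 1).const_mul _).div_const _
  have i02 : Integrable (fun ω : EuclideanSpace ℝ (Fin d) => 1 + σ ^ 2 * ‖ω‖ ^ 2 / d)
      (freqGaussian d σ) := (integrable_const _).add i2
  simp only [freqWeight_sq hσ hd]
  rw [integral_const_mul, integral_add i02
    ((integrable_norm_pow hσ hd 2).div_const _), integral_add (integrable_const _) i2, h2, h4]
  norm_num

theorem isProbabilityMeasure_freqMeasure (hσ : 0 < σ) (hd : 1 ≤ d) :
    IsProbabilityMeasure (freqMeasure d σ) := by
  constructor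
  rw [freqMeasure, withDensity_apply _ MeasurableSet.univ, Measure.restrict_univ,
    ← ofReal_integral_eq_lintegral_ofReal (integrable_freqWeight_sq hσ hd)
      (.of_forall fun _ => by positivity), integral_freqWeight_sq hσ hd, ENNReal.ofReal_one]

theorem integral_freqMeasure (g : EuclideanSpace ℝ (Fin d) → ℝ) :
    ∫ ω, g ω ∂(freqMeasure d σ) = ∫ ω, freqWeight σ ω ^ 2 * g ω ∂(freqGaussian d σ) := by
  rw [freqMeasure, integral_withDensity_eq_integral_toReal_smul
    (measurable_freqWeight.pow_const 2).ennreal_ofReal (.of_forall fun _ => ENNReal.ofReal_lt_top)]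
  simp [ENNReal.toReal_ofReal, sq_nonneg]

theorem integrable_freqMeasure_iff (g : EuclideanSpace ℝ (Fin d) → ℝ) :
    Integrable g (freqMeasure d σ) ↔
      Integrable (fun ω => freqWeight σ ω ^ 2 * g ω) (freqGaussian d σ) := by
  rw [freqMeasure, integrable_withDensity_iff_integrable_smul'
    (measurable_freqWeight.pow_const 2).ennreal_ofReal (.of_forall fun _ => ENNReal.ofReal_lt_top)]
  simp [ENNReal.toReal_ofReal, sq_nonneg]

end Weight

/-! ### Concentration of empirical means -/

/-- Chernoff bound for the mean of `m` independent copies of `X`. -/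
theorem measure_pi_sum_ge_le {Ω : Type*} [MeasurableSpace Ω] (ν : Measure Ω)
    [IsProbabilityMeasure ν] {X : Ω → ℝ} {a V τ lam : ℝ}
    (hlam : 0 ≤ lam) (hint : Integrable (fun ω => Real.exp (lam * X ω)) ν)
    (hmgf : ∫ ω, Real.exp (lam * X ω) ∂ν ≤ Real.exp (lam * a + V * lam ^ 2)) (m : ℕ) :
    Measure.pi (fun _ : Fin m => ν) {w | m * (a + τ) ≤ ∑ j, X (w j)} ≤
      ENNReal.ofReal (Real.exp (-(m * (lam * τ - V * lam ^ 2)))) := by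
  set P := Measure.pi (fun _ : Fin m => ν)
  have hI : Integrable (fun w : Fin m → Ω => ∏ j, Real.exp (lam * X (w j))) P :=
    Integrable.fintype_prod fun _ => hint
  have hmarkov := mul_meas_ge_le_integral_of_nonneg (μ := P)
    (.of_forall fun w => Finset.prod_nonneg fun j _ => (Real.exp_pos (lam * X (w j))).le) hI
    (Real.exp (lam * (m * (a + τ))))
  rw [integral_fintype_prod_eq_pow (fun ω => Real.exp (lam * X ω)), Fintype.card_fin] at hmarkov
  have hsub : {w : Fin m → Ω | m * (a + τ) ≤ ∑ j, X (w j)} ⊆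
      {w | Real.exp (lam * (m * (a + τ))) ≤ ∏ j, Real.exp (lam * X (w j))} := by
    intro w hw
    rw [Set.mem_ofPred_eq, ← Real.exp_sum, ← Finset.mul_sum]
    exact Real.exp_le_exp.2 (mul_le_mul_of_nonneg_left hw hlam)
  refine (measure_mono hsub).trans ?_
  rw [← ofReal_measureReal]
  refine ENNReal.ofReal_le_ofReal ?_
  have hpow : (∫ ω, Real.exp (lam * X ω) ∂ν) ^ m ≤ Real.exp (m * (lam * a + V * lam ^ 2)) := by
    rw [Real.exp_nat_mul]
    exact pow_le_pow_left₀ (integral_nonneg fun _ => (Real.exp_pos _).le) hmgf m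
  have h := hmarkov.trans hpow
  rw [← le_div_iff₀' (Real.exp_pos _), ← Real.exp_sub] at h
  refine h.trans_eq ?_
  congr 1
  ring

section Tails

variable {d : ℕ} {σ : ℝ}

/-- The numerical constant of the exponential moment bound. -/
theorem sqrt_two_mul_exp_half_le : 384 * (Real.exp (1 / 2) * Real.sqrt 2) ≤ 900 := by
  have h1 : Real.sqrt 2 ≤ 1.415 := by
    rw [Real.sqrt_le_left (by norm_num)]; norm_num
  have h2 : Real.exp (1 / 2) ≤ 1.65 := by
    have h : Real.exp (1 / 2) ^ 2 ≤ 1.65 ^ 2 := by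
      rw [← Real.exp_nat_mul]
      norm_num
      linarith [Real.exp_one_lt_d9]
    exact le_of_sq_le_sq h (by norm_num)
  have := mul_le_mul h2 h1 (Real.sqrt_nonneg _) (by norm_num)
  nlinarith

/-- Exponential expansion of the reweighted variable `Y / f²`, with the density `f²` in front:
the quadratic remainder is multiplied by `f² · f⁻⁴ = f⁻² ≤ 3`. -/
theorem freqWeight_sq_mul_exp_le (hσ : 0 < σ) (hd : 1 ≤ d) {ω : EuclideanSpace ℝ (Fin d)}
    {y z lam : ℝ} (hy : 0 ≤ y) (hyz : y ≤ z ^ 2 + 2) (hlam : |lam| ≤ 1 / 24) :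
    freqWeight σ ω ^ 2 * Real.exp (lam * (y / freqWeight σ ω ^ 2)) ≤
      freqWeight σ ω ^ 2 + lam * y +
        384 * lam ^ 2 * Real.exp (1 / 2) * Real.exp (z ^ 2 / 4) := by
  have hF := freqWeight_sq_pos hσ hd ω
  have hF3 := one_third_le_freqWeight_sq hσ hd ω
  set F := freqWeight σ ω ^ 2
  set W := z ^ 2 + 2 with hW
  have hW0 : 0 ≤ W := hy.trans hyz
  have hinv : 1 / F ≤ 3 := by
    rw [div_le_iff₀ hF]; linarith
  have hq : y / F ≤ 3 * W := by
    rw [div_eq_mul_one_div]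
    nlinarith [mul_le_mul hyz hinv (by positivity) hW0]
  have hexp : Real.exp |lam * (y / F)| ≤ Real.exp (W / 8) := by
    refine Real.exp_le_exp.2 ?_
    rw [abs_mul, abs_of_nonneg (by positivity : 0 ≤ y / F)]
    nlinarith [mul_le_mul hlam hq (by positivity) (by norm_num : (0 : ℝ) ≤ 1 / 24)]
  have h1 := (abs_le.1 (abs_exp_sub_one_sub_le (lam * (y / F)))).2
  have h2 : W ^ 2 ≤ 128 * Real.exp (W / 8) := by
    have := Real.pow_div_factorial_le_exp (x := W / 8) (by positivity) 2
    norm_num [Nat.factorial] at this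
    linarith
  have h3 : (lam * (y / F)) ^ 2 * Real.exp |lam * (y / F)| ≤
      (lam * (y / F)) ^ 2 * Real.exp (W / 8) :=
    mul_le_mul_of_nonneg_left hexp (sq_nonneg _)
  have h4 : F * (lam * (y / F)) ^ 2 ≤ lam ^ 2 * (3 * W ^ 2) := by
    have : F * (lam * (y / F)) ^ 2 = lam ^ 2 * (y ^ 2 * (1 / F)) := by field_simp
    rw [this]
    refine mul_le_mul_of_nonneg_left ?_ (sq_nonneg _)
    have := mul_le_mul (pow_le_pow_left₀ hy hyz 2) hinv (by positivity) (by positivity)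
    linarith
  have h5 : Real.exp (W / 8) * Real.exp (W / 8) =
      Real.exp (1 / 2) * Real.exp (z ^ 2 / 4) := by
    rw [← Real.exp_add, ← Real.exp_add, hW]
    congr 1
    ring
  have hE := Real.exp_pos (W / 8)
  calc F * Real.exp (lam * (y / F))
      ≤ F * (1 + lam * (y / F) + (lam * (y / F)) ^ 2 * Real.exp (W / 8)) :=
        mul_le_mul_of_nonneg_left (by linarith) hF.le
    _ = F + lam * y + F * (lam * (y / F)) ^ 2 * Real.exp (W / 8) := by
        field_simp
    _ ≤ F + lam * y + lam ^ 2 * (3 * (128 * Real.exp (W / 8))) * Real.exp (W / 8) := by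
        have := mul_le_mul_of_nonneg_right
          (h4.trans (mul_le_mul_of_nonneg_left (mul_le_mul_of_nonneg_left h2 (by norm_num))
            (sq_nonneg lam))) hE.le
        linarith
    _ = F + lam * y + 384 * lam ^ 2 * (Real.exp (W / 8) * Real.exp (W / 8)) := by ring
    _ = _ := by rw [h5]; ring

theorem integrable_of_le_inner_sq (hσ : 0 < σ) {v : EuclideanSpace ℝ (Fin d)} (hv : ‖v‖ = σ)
    {Y : EuclideanSpace ℝ (Fin d) → ℝ} (hY : Measurable Y) (hY0 : ∀ ω, 0 ≤ Y ω)
    (hYv : ∀ ω, Y ω ≤ inner ℝ ω v ^ 2 + 2) : Integrable Y (freqGaussian d σ) :=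
  ((integrable_inner_sq hσ hv).add (integrable_const 2)).mono' hY.aestronglyMeasurable
    (.of_forall fun ω => by rw [Real.norm_of_nonneg (hY0 ω)]; exact hYv ω)

/-- The reweighted variable `Y / f²` is sub-exponential with absolute constants, although it is
only bounded by a multiple of the dimension. -/
theorem integral_exp_div_freqWeight_sq_le (hσ : 0 < σ) (hd : 1 ≤ d)
    {v : EuclideanSpace ℝ (Fin d)} (hv : ‖v‖ = σ)
    {Y : EuclideanSpace ℝ (Fin d) → ℝ} (hY : Measurable Y) (hY0 : ∀ ω, 0 ≤ Y ω)
    (hYv : ∀ ω, Y ω ≤ inner ℝ ω v ^ 2 + 2) {lam : ℝ} (hlam : |lam| ≤ 1 / 24) :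
    Integrable (fun ω => Real.exp (lam * (Y ω / freqWeight σ ω ^ 2))) (freqMeasure d σ) ∧
      ∫ ω, Real.exp (lam * (Y ω / freqWeight σ ω ^ 2)) ∂(freqMeasure d σ) ≤
        Real.exp (lam * ∫ ω, Y ω ∂(freqGaussian d σ) + 900 * lam ^ 2) := by
  have hle := fun ω => freqWeight_sq_mul_exp_le hσ hd (ω := ω) (hY0 ω) (hYv ω) hlam
  have i1 := integrable_freqWeight_sq hσ hd
  have i2 := (integrable_of_le_inner_sq hσ hv hY hY0 hYv).const_mul lam
  have i3 := (integrable_exp_inner_sq hσ hv).const_mul (384 * lam ^ 2 * Real.exp (1 / 2))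
  have hm : Measurable (freqWeight (d := d) σ) := measurable_freqWeight
  have i0 : Integrable (fun ω => freqWeight σ ω ^ 2 *
      Real.exp (lam * (Y ω / freqWeight σ ω ^ 2))) (freqGaussian d σ) := by
    refine ((i1.add i2).add i3).mono' (by fun_prop) (.of_forall fun ω => ?_)
    rw [Real.norm_of_nonneg (by positivity)]
    exact hle ω
  refine ⟨(integrable_freqMeasure_iff _).2 i0, ?_⟩
  rw [integral_freqMeasure]
  refine (integral_mono i0 ((i1.add i2).add i3) hle).trans ?_
  have i12 : Integrable (fun ω => freqWeight σ ω ^ 2 + lam * Y ω) (freqGaussian d σ) := i1.add i2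
  simp only [Pi.add_apply]
  rw [integral_add i12 i3, integral_add i1 i2, integral_freqWeight_sq hσ hd,
    integral_const_mul, integral_const_mul, integral_exp_inner_sq hσ hv]
  have h1 := Real.add_one_le_exp (lam * ∫ ω, Y ω ∂(freqGaussian d σ) + 900 * lam ^ 2)
  nlinarith [sqrt_two_mul_exp_half_le, sq_nonneg lam]

/-- Dimension-free tail bound. The bound has no factor in front of the exponential, so it remains
meaningful for events whose required probability is close to zero. -/
theorem freqLaw_upper_tail (hσ : 0 < σ) (hd : 1 ≤ d) {v : EuclideanSpace ℝ (Fin d)}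
    (hv : ‖v‖ = σ) {Y : EuclideanSpace ℝ (Fin d) → ℝ} (hY : Measurable Y)
    (hY0 : ∀ ω, 0 ≤ Y ω) (hYv : ∀ ω, Y ω ≤ inner ℝ ω v ^ 2 + 2) {τ : ℝ} (hτ0 : 0 ≤ τ)
    (hτ1 : τ ≤ 1) (m : ℕ) :
    freqLaw d m σ {w | m * (∫ ω, Y ω ∂(freqGaussian d σ) + τ) ≤
        ∑ j, Y (w j) / freqWeight σ (w j) ^ 2} ≤
      ENNReal.ofReal (Real.exp (-(m * τ ^ 2 / 3600))) := by
  have := isProbabilityMeasure_freqMeasure hσ hd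
  obtain ⟨h1, h2⟩ := integral_exp_div_freqWeight_sq_le hσ hd hv hY hY0 hYv (lam := τ / 1800)
    (by rw [abs_of_nonneg (by positivity)]; linarith)
  refine (measure_pi_sum_ge_le (freqMeasure d σ) (by positivity) h1 h2 m).trans_eq ?_
  congr 2
  ring

theorem freqLaw_lower_tail (hσ : 0 < σ) (hd : 1 ≤ d) {v : EuclideanSpace ℝ (Fin d)}
    (hv : ‖v‖ = σ) {Y : EuclideanSpace ℝ (Fin d) → ℝ} (hY : Measurable Y)
    (hY0 : ∀ ω, 0 ≤ Y ω) (hYv : ∀ ω, Y ω ≤ inner ℝ ω v ^ 2 + 2) {τ : ℝ} (hτ0 : 0 ≤ τ)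
    (hτ1 : τ ≤ 1) (m : ℕ) :
    freqLaw d m σ {w | ∑ j, Y (w j) / freqWeight σ (w j) ^ 2 ≤
        m * (∫ ω, Y ω ∂(freqGaussian d σ) - τ)} ≤
      ENNReal.ofReal (Real.exp (-(m * τ ^ 2 / 3600))) := by
  have := isProbabilityMeasure_freqMeasure hσ hd
  obtain ⟨h1, h2⟩ := integral_exp_div_freqWeight_sq_le hσ hd hv hY hY0 hYv (lam := -(τ / 1800))
    (by rw [abs_neg, abs_of_nonneg (by positivity)]; linarith)
  have h := measure_pi_sum_ge_le (freqMeasure d σ) (X := fun ω => -(Y ω / freqWeight σ ω ^ 2))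
    (a := -∫ ω, Y ω ∂(freqGaussian d σ)) (V := 900) (τ := τ) (lam := τ / 1800) (by positivity)
    (by simpa only [neg_mul, mul_neg] using h1)
    (by simpa only [neg_mul, mul_neg, neg_sq] using h2) m
  refine le_trans (measure_mono fun w hw => ?_) (h.trans_eq ?_)
  · rw [Set.mem_ofPred_eq] at hw ⊢
    rw [Finset.sum_neg_distrib]
    linarith
  · congr 2
    ring

end Tails

/-! ### The squared kernel metric and its empirical counterpart -/

noncomputable section

/-- The square of the Gaussian kernel metric, as a function of the difference `u = x - x'`. -/
def sqKernelMetric {d : ℕ} (σ : ℝ) (u : EuclideanSpace ℝ (Fin d)) : ℝ :=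
  2 * (1 - Real.exp (-(‖u‖ ^ 2 / (2 * σ ^ 2))))

/-- The squared distance `‖Ψ x - Ψ x'‖²` of the random features, as a function of `u = x - x'`. -/
def empiricalSqMetric {d m : ℕ} (σ : ℝ) (w : Fin m → EuclideanSpace ℝ (Fin d))
    (u : EuclideanSpace ℝ (Fin d)) : ℝ :=
  1 / m * ∑ j, 2 * (1 - Real.cos (inner ℝ (w j) u)) / freqWeight σ (w j) ^ 2

end

section Metric

variable {d m : ℕ} {σ : ℝ}

theorem norm_sq_exp_sub_exp (a b : ℝ) :
    ‖Complex.exp (Complex.I * a) - Complex.exp (Complex.I * b)‖ ^ 2 =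
      2 * (1 - Real.cos (a - b)) := by
  rw [← Complex.normSq_eq_norm_sq, mul_comm Complex.I, mul_comm Complex.I, Complex.normSq_apply]
  simp only [Complex.sub_re, Complex.sub_im, Complex.exp_ofReal_mul_I_re,
    Complex.exp_ofReal_mul_I_im, Real.cos_sub]
  nlinarith [Real.sin_sq_add_cos_sq a, Real.sin_sq_add_cos_sq b]

theorem norm_sq_randomFourierMap_sub (w : Fin m → EuclideanSpace ℝ (Fin d))
    (x x' : EuclideanSpace ℝ (Fin d)) :
    ‖randomFourierMap σ w x - randomFourierMap σ w x'‖ ^ 2 = empiricalSqMetric σ w (x - x') := by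
  rw [EuclideanSpace.norm_sq_eq, empiricalSqMetric, Finset.mul_sum]
  refine Finset.sum_congr rfl fun j _ => ?_
  simp only [randomFourierMap, PiLp.sub_apply, fourierFeature]
  rw [← mul_sub, ← sub_div, norm_mul, norm_div, mul_pow, div_pow, norm_sq_exp_sub_exp,
    Complex.norm_real, Complex.norm_real, Real.norm_eq_abs, Real.norm_eq_abs, sq_abs, sq_abs,
    div_pow, Real.sq_sqrt (Nat.cast_nonneg m), one_pow, inner_sub_right]

theorem sqKernelMetric_nonneg (u : EuclideanSpace ℝ (Fin d)) : 0 ≤ sqKernelMetric σ u := by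
  have : Real.exp (-(‖u‖ ^ 2 / (2 * σ ^ 2))) ≤ 1 := by
    rw [Real.exp_le_one_iff, neg_nonpos]; positivity
  rw [sqKernelMetric]
  linarith

theorem gaussianKernelMetric_sq (x x' : EuclideanSpace ℝ (Fin d)) :
    gaussianKernelMetric σ x x' ^ 2 = sqKernelMetric σ (x - x') :=
  Real.sq_sqrt (sqKernelMetric_nonneg (x - x'))

theorem sqKernelMetric_le (u : EuclideanSpace ℝ (Fin d)) :
    sqKernelMetric σ u ≤ ‖u‖ ^ 2 / σ ^ 2 := by
  have := Real.add_one_le_exp (-(‖u‖ ^ 2 / (2 * σ ^ 2)))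
  have h : ‖u‖ ^ 2 / σ ^ 2 = 2 * (‖u‖ ^ 2 / (2 * σ ^ 2)) := by field_simp
  rw [sqKernelMetric, h]
  linarith

theorem le_sqKernelMetric (u : EuclideanSpace ℝ (Fin d)) :
    2 * (‖u‖ ^ 2 / σ ^ 2) / (2 + ‖u‖ ^ 2 / σ ^ 2) ≤ sqKernelMetric σ u := by
  have h := div_one_add_le_one_sub_exp_neg (y := ‖u‖ ^ 2 / (2 * σ ^ 2)) (by positivity)
  have ha : ‖u‖ ^ 2 / (2 * σ ^ 2) = ‖u‖ ^ 2 / σ ^ 2 / 2 := by field_simp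
  have ha0 : 0 ≤ ‖u‖ ^ 2 / σ ^ 2 := by positivity
  rw [sqKernelMetric]
  refine le_trans (le_of_eq ?_) (mul_le_mul_of_nonneg_left h zero_le_two)
  rw [ha]
  generalize ‖u‖ ^ 2 / σ ^ 2 = a at ha0
  field_simp

theorem sqKernelMetric_pos (hσ : 0 < σ) {u : EuclideanSpace ℝ (Fin d)} (hu : u ≠ 0) :
    0 < sqKernelMetric σ u := by
  have : 0 < ‖u‖ := norm_pos_iff.2 hu
  exact lt_of_lt_of_le (by positivity) (le_sqKernelMetric u)

theorem integrable_cos_inner (u : EuclideanSpace ℝ (Fin d)) :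
    Integrable (fun ω => Real.cos (inner ℝ ω u)) (freqGaussian d σ) :=
  (integrable_const (1 : ℝ)).mono' (by fun_prop) (.of_forall fun _ => Real.abs_cos_le_one _)

theorem integral_two_mul_one_sub_cos (u : EuclideanSpace ℝ (Fin d)) :
    ∫ ω, 2 * (1 - Real.cos (inner ℝ ω u)) ∂(freqGaussian d σ) = sqKernelMetric σ u := by
  rw [integral_const_mul, integral_sub (integrable_const _) (integrable_cos_inner u),
    integral_cos_inner_freqGaussian]
  simp [sqKernelMetric]

/-- The normalized increments are dominated by a standard normal square, uniformly in `u`: for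
small `u` because `2 (1 - cos z) ≤ z²`, for large `u` because `2 (1 - cos z) ≤ 4`. -/
theorem two_mul_one_sub_cos_div_le (hσ : 0 < σ) {u : EuclideanSpace ℝ (Fin d)} (hu : u ≠ 0)
    (ω : EuclideanSpace ℝ (Fin d)) :
    2 * (1 - Real.cos (inner ℝ ω u)) / sqKernelMetric σ u ≤
      inner ℝ ω ((σ / ‖u‖) • u) ^ 2 + 2 := by
  have hn : 0 < ‖u‖ := norm_pos_iff.2 hu
  have hh := sqKernelMetric_pos hσ hu
  have hle := le_sqKernelMetric (σ := σ) u
  have hz1 : 2 * (1 - Real.cos (inner ℝ ω u)) ≤ inner ℝ ω u ^ 2 := by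
    linarith [Real.one_sub_sq_div_two_le_cos (x := inner ℝ ω u)]
  have hz2 : 2 * (1 - Real.cos (inner ℝ ω u)) ≤ 4 := by
    linarith [Real.neg_one_le_cos (inner ℝ ω u)]
  have ha : 0 < ‖u‖ ^ 2 / σ ^ 2 := by positivity
  have hv : inner ℝ ω ((σ / ‖u‖) • u) ^ 2 = inner ℝ ω u ^ 2 / (‖u‖ ^ 2 / σ ^ 2) := by
    rw [inner_smul_right]
    field_simp
  rw [hv, div_le_iff₀ hh]
  generalize ‖u‖ ^ 2 / σ ^ 2 = a at *
  generalize inner ℝ ω u = z at *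
  have h0 : 0 ≤ z ^ 2 / a + 2 := by positivity
  refine le_trans ?_ (mul_le_mul_of_nonneg_left hle h0)
  have : (z ^ 2 / a + 2) * (2 * a / (2 + a)) = (2 * z ^ 2 + a * 4) / (2 + a) := by
    field_simp
    ring
  rw [this, le_div_iff₀ (by positivity)]
  nlinarith

theorem norm_div_norm_smul (hσ : 0 < σ) {u : EuclideanSpace ℝ (Fin d)} (hu : u ≠ 0) :
    ‖(σ / ‖u‖) • u‖ = σ := by
  have hn : ‖u‖ ≠ 0 := norm_ne_zero_iff.2 hu
  rw [norm_smul, norm_div, norm_norm, Real.norm_of_nonneg hσ.le, div_mul_cancel₀ _ hn]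

theorem integral_two_mul_one_sub_cos_div (hσ : 0 < σ) {u : EuclideanSpace ℝ (Fin d)}
    (hu : u ≠ 0) :
    ∫ ω, 2 * (1 - Real.cos (inner ℝ ω u)) / sqKernelMetric σ u ∂(freqGaussian d σ) = 1 := by
  rw [integral_div, integral_two_mul_one_sub_cos, div_self (sqKernelMetric_pos hσ hu).ne']

theorem sum_div_sqKernelMetric (hm : 0 < m) (u : EuclideanSpace ℝ (Fin d))
    (w : Fin m → EuclideanSpace ℝ (Fin d)) :
    ∑ j, 2 * (1 - Real.cos (inner ℝ (w j) u)) / sqKernelMetric σ u / freqWeight σ (w j) ^ 2 =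
      m * (empiricalSqMetric σ w u / sqKernelMetric σ u) := by
  have hm0 : (m : ℝ) ≠ 0 := by positivity
  rw [empiricalSqMetric, ← mul_div_assoc, ← mul_assoc, mul_one_div_cancel hm0, one_mul,
    Finset.sum_div]
  exact Finset.sum_congr rfl fun j _ => div_right_comm _ _ _

theorem freqLaw_empiricalSqMetric_ge (hσ : 0 < σ) (hd : 1 ≤ d) (hm : 0 < m)
    {u : EuclideanSpace ℝ (Fin d)} (hu : u ≠ 0) {τ : ℝ} (hτ0 : 0 ≤ τ) (hτ1 : τ ≤ 1) :
    freqLaw d m σ {w | (1 + τ) * sqKernelMetric σ u ≤ empiricalSqMetric σ w u} ≤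
      ENNReal.ofReal (Real.exp (-(m * τ ^ 2 / 3600))) := by
  have hh := sqKernelMetric_pos hσ hu
  have h := freqLaw_upper_tail hσ hd (norm_div_norm_smul hσ hu)
    (Y := fun ω => 2 * (1 - Real.cos (inner ℝ ω u)) / sqKernelMetric σ u) (by fun_prop)
    (fun ω => div_nonneg (by linarith [Real.cos_le_one (inner ℝ ω u)]) hh.le)
    (two_mul_one_sub_cos_div_le hσ hu) hτ0 hτ1 m
  refine (measure_mono fun w hw => ?_).trans h
  rw [Set.mem_ofPred_eq] at hw ⊢
  rw [integral_two_mul_one_sub_cos_div hσ hu, sum_div_sqKernelMetric hm u]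
  gcongr
  rwa [le_div_iff₀ hh]

theorem freqLaw_empiricalSqMetric_le (hσ : 0 < σ) (hd : 1 ≤ d) (hm : 0 < m)
    {u : EuclideanSpace ℝ (Fin d)} (hu : u ≠ 0) {τ : ℝ} (hτ0 : 0 ≤ τ) (hτ1 : τ ≤ 1) :
    freqLaw d m σ {w | empiricalSqMetric σ w u ≤ (1 - τ) * sqKernelMetric σ u} ≤
      ENNReal.ofReal (Real.exp (-(m * τ ^ 2 / 3600))) := by
  have hh := sqKernelMetric_pos hσ hu
  have h := freqLaw_lower_tail hσ hd (norm_div_norm_smul hσ hu)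
    (Y := fun ω => 2 * (1 - Real.cos (inner ℝ ω u)) / sqKernelMetric σ u) (by fun_prop)
    (fun ω => div_nonneg (by linarith [Real.cos_le_one (inner ℝ ω u)]) hh.le)
    (two_mul_one_sub_cos_div_le hσ hu) hτ0 hτ1 m
  refine (measure_mono fun w hw => ?_).trans h
  rw [Set.mem_ofPred_eq] at hw ⊢
  rw [integral_two_mul_one_sub_cos_div hσ hu, sum_div_sqKernelMetric hm u]
  gcongr
  rwa [div_le_iff₀ hh]

/-! ### Lipschitz bounds -/

theorem abs_cos_inner_sub_le (hσ : 0 < σ) (hd : 1 ≤ d) (ω u n : EuclideanSpace ℝ (Fin d)) :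
    |2 * (1 - Real.cos (inner ℝ ω u)) - 2 * (1 - Real.cos (inner ℝ ω n))| ≤
      freqWeight σ ω ^ 2 * (3 * (Real.sqrt d / σ) * ‖u - n‖) := by
  have h1 : |Real.cos (inner ℝ ω u) - Real.cos (inner ℝ ω n)| ≤ ‖ω‖ * ‖u - n‖ := by
    refine (Real.abs_cos_sub_cos_le _ _).trans ?_
    rw [← inner_sub_right]
    exact abs_real_inner_le_norm _ _
  have h2 := mul_le_mul_of_nonneg_right (norm_le_freqWeight_sq hσ hd ω) (norm_nonneg (u - n))
  rw [show 2 * (1 - Real.cos (inner ℝ ω u)) - 2 * (1 - Real.cos (inner ℝ ω n)) =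
    (-2) * (Real.cos (inner ℝ ω u) - Real.cos (inner ℝ ω n)) by ring, abs_mul]
  norm_num
  linarith

theorem abs_sqKernelMetric_sub_le (hσ : 0 < σ) (hd : 1 ≤ d) (u n : EuclideanSpace ℝ (Fin d)) :
    |sqKernelMetric σ u - sqKernelMetric σ n| ≤ 3 * (Real.sqrt d / σ) * ‖u - n‖ := by
  have hint (u : EuclideanSpace ℝ (Fin d)) :
      Integrable (fun ω => 2 * (1 - Real.cos (inner ℝ ω u))) (freqGaussian d σ) :=
    ((integrable_const 1).sub (integrable_cos_inner (σ := σ) u)).const_mul 2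
  rw [← integral_two_mul_one_sub_cos u, ← integral_two_mul_one_sub_cos n,
    ← integral_sub (hint u) (hint n)]
  refine (norm_integral_le_of_norm_le
    (f := fun ω => 2 * (1 - Real.cos (inner ℝ ω u)) - 2 * (1 - Real.cos (inner ℝ ω n)))
    ((integrable_freqWeight_sq hσ hd).mul_const _)
    (.of_forall fun ω => abs_cos_inner_sub_le hσ hd ω u n)).trans_eq ?_
  rw [integral_mul_const, integral_freqWeight_sq hσ hd, one_mul]

theorem abs_empiricalSqMetric_sub_le (hσ : 0 < σ) (hd : 1 ≤ d)
    (w : Fin m → EuclideanSpace ℝ (Fin d)) (u n : EuclideanSpace ℝ (Fin d)) :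
    |empiricalSqMetric σ w u - empiricalSqMetric σ w n| ≤
      3 * (Real.sqrt d / σ) * ‖u - n‖ := by
  set L := 3 * (Real.sqrt d / σ) * ‖u - n‖ with hL
  have hL0 : 0 ≤ L := by positivity
  have hsum : |∑ j, (2 * (1 - Real.cos (inner ℝ (w j) u)) / freqWeight σ (w j) ^ 2 -
      2 * (1 - Real.cos (inner ℝ (w j) n)) / freqWeight σ (w j) ^ 2)| ≤ m * L := by
    refine (Finset.abs_sum_le_sum_abs _ _).trans ?_
    refine (Finset.sum_le_sum (g := fun _ => L) fun j _ => ?_).trans_eq (by simp)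
    have hF := freqWeight_sq_pos hσ hd (w j)
    rw [← sub_div, abs_div, abs_of_pos hF, div_le_iff₀' hF]
    exact abs_cos_inner_sub_le hσ hd (w j) u n
  rw [empiricalSqMetric, empiricalSqMetric, ← mul_sub, ← Finset.sum_sub_distrib, abs_mul,
    abs_of_nonneg (by positivity)]
  refine (mul_le_mul_of_nonneg_left hsum (by positivity)).trans ?_
  rcases Nat.eq_zero_or_pos m with rfl | hm
  · simpa using hL0
  · have : (m : ℝ) ≠ 0 := by positivity
    rw [← mul_assoc, one_div_mul_cancel this, one_mul]

/-- Away from the origin, a lower bound with some slack on a fine enough net extends to all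
points. -/
theorem sqKernelMetric_le_of_near (hσ : 0 < σ) (hd : 1 ≤ d) {t : ℝ} (ht0 : 0 < t) (ht1 : t < 1)
    (w : Fin m → EuclideanSpace ℝ (Fin d)) {u n : EuclideanSpace ℝ (Fin d)}
    (hu : t * Real.sqrt t / (400 * d) ≤ ‖u‖ ^ 2 / σ ^ 2)
    (hun : ‖u - n‖ ≤ σ * t ^ 3 / (9600 * d ^ 2))
    (hn : (1 - t / 2) * sqKernelMetric σ n ≤ empiricalSqMetric σ w n) :
    (1 - t) * sqKernelMetric σ u ≤ empiricalSqMetric σ w u := by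
  have hd1 : (1 : ℝ) ≤ d := by exact_mod_cast hd
  have hs1 : 0 < Real.sqrt t := Real.sqrt_pos.2 ht0
  have hs2 : Real.sqrt t ^ 2 = t := Real.sq_sqrt ht0.le
  have hs3 : Real.sqrt t ≤ 1 := Real.sqrt_le_one.2 ht1.le
  have hsd : Real.sqrt d ≤ d := by
    rw [Real.sqrt_le_left (by positivity)]; nlinarith
  have hb1 : t * Real.sqrt t / (400 * d) ≤ 1 := by
    rw [div_le_one (by positivity)]; nlinarith
  have hh : 2 / 3 * (t * Real.sqrt t / (400 * d)) ≤ sqKernelMetric σ u := by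
    refine le_trans ?_ (le_sqKernelMetric u)
    have hb0 : 0 < t * Real.sqrt t / (400 * d) := by positivity
    generalize t * Real.sqrt t / (400 * d) = b at *
    generalize ‖u‖ ^ 2 / σ ^ 2 = a at *
    rw [le_div_iff₀ (by linarith)]
    nlinarith
  have hLip : 3 * (Real.sqrt d / σ) * ‖u - n‖ ≤ t ^ 3 / (3200 * d) := by
    calc 3 * (Real.sqrt d / σ) * ‖u - n‖
        ≤ 3 * (d / σ) * (σ * t ^ 3 / (9600 * d ^ 2)) := by gcongr
      _ = t ^ 3 / (3200 * d) := by field_simp; norm_num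
  have hcmp : 2 * (t ^ 3 / (3200 * d)) ≤ t / 2 * (2 / 3 * (t * Real.sqrt t / (400 * d))) := by
    have h1 : t / 2 * (2 / 3 * (t * Real.sqrt t / (400 * d))) =
        t ^ 2 * Real.sqrt t / (1200 * d) := by field_simp; norm_num
    have h2 : 2 * (t ^ 3 / (3200 * d)) = t ^ 3 / (1600 * d) := by field_simp; norm_num
    rw [h1, h2]
    gcongr
    · nlinarith [mul_le_mul_of_nonneg_left hs3 (by positivity : 0 ≤ t ^ 2 * Real.sqrt t)]
    · norm_num
  have h1 := abs_le.1 (abs_sqKernelMetric_sub_le hσ hd u n)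
  have h2 := abs_le.1 (abs_empiricalSqMetric_sub_le hσ hd w u n)
  have h3 := sqKernelMetric_nonneg (σ := σ) n
  have h4 : t / 2 * (2 / 3 * (t * Real.sqrt t / (400 * d))) ≤ t / 2 * sqKernelMetric σ u :=
    mul_le_mul_of_nonneg_left hh (by positivity)
  have hL0 : 0 ≤ 3 * (Real.sqrt d / σ) * ‖u - n‖ := by positivity
  nlinarith [h1.1, h1.2, h2.1, h2.2]

end Metric

/-! ### The truncated quadratic form -/

noncomputable section

/-- The squared projection `⟨ω, v⟩²` of a frequency, set to zero when the normalized squared norm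
`σ² ‖ω‖² / d` exceeds `K`. -/
def truncSq {d : ℕ} (σ K : ℝ) (v ω : EuclideanSpace ℝ (Fin d)) : ℝ :=
  Set.indicator {ω | σ ^ 2 * ‖ω‖ ^ 2 / d ≤ K} (fun ω => inner ℝ ω v ^ 2) ω

/-- The empirical mean of the reweighted truncated squared projections, a quadratic form in `v`. -/
def empiricalTruncSq {d m : ℕ} (σ K : ℝ) (w : Fin m → EuclideanSpace ℝ (Fin d))
    (v : EuclideanSpace ℝ (Fin d)) : ℝ :=
  1 / m * ∑ j, truncSq σ K v (w j) / freqWeight σ (w j) ^ 2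

end

section Truncation

variable {d m : ℕ} {σ K t : ℝ}

theorem truncSq_nonneg (v ω : EuclideanSpace ℝ (Fin d)) : 0 ≤ truncSq σ K v ω :=
  Set.indicator_nonneg (fun _ _ => sq_nonneg _) _

theorem truncSq_le (v ω : EuclideanSpace ℝ (Fin d)) : truncSq σ K v ω ≤ inner ℝ ω v ^ 2 :=
  Set.indicator_le_self' (fun _ _ => sq_nonneg _) _

theorem measurable_truncSq (v : EuclideanSpace ℝ (Fin d)) : Measurable (truncSq σ K v) :=
  Measurable.indicator (by fun_prop) (measurableSet_le (by fun_prop) (by fun_prop))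

theorem truncSq_smul (c : ℝ) (v ω : EuclideanSpace ℝ (Fin d)) :
    truncSq σ K (c • v) ω = c ^ 2 * truncSq σ K v ω := by
  unfold truncSq
  by_cases h : σ ^ 2 * ‖ω‖ ^ 2 / d ≤ K
  · simp [Set.indicator, h, inner_smul_right, mul_pow]
  · simp [Set.indicator, h]

/-- On the truncation event the quartic Taylor remainder is a small multiple of the square. -/
theorem mul_truncSq_le_two_mul_one_sub_cos (hσ : 0 < σ) (hd : 1 ≤ d)
    (u ω : EuclideanSpace ℝ (Fin d)) :
    (1 - K * d * (‖u‖ ^ 2 / σ ^ 2)) * truncSq σ K u ω ≤ 2 * (1 - Real.cos (inner ℝ ω u)) := by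
  by_cases h : σ ^ 2 * ‖ω‖ ^ 2 / d ≤ K
  · have hd0 : (0 : ℝ) < d := by positivity
    have h1 := sq_sub_pow_four_le_two_mul_one_sub_cos (inner ℝ ω u)
    have h2 : inner ℝ ω u ^ 2 ≤ K * d * (‖u‖ ^ 2 / σ ^ 2) := by
      have h3 : inner ℝ ω u ^ 2 ≤ (‖ω‖ * ‖u‖) ^ 2 := by
        rw [← sq_abs (inner ℝ ω u)]
        exact pow_le_pow_left₀ (abs_nonneg _) (abs_real_inner_le_norm ω u) 2
      calc inner ℝ ω u ^ 2 ≤ (‖ω‖ * ‖u‖) ^ 2 := h3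
        _ = σ ^ 2 * ‖ω‖ ^ 2 / d * d * (‖u‖ ^ 2 / σ ^ 2) := by field_simp
        _ ≤ _ := by gcongr
    have h4 : truncSq σ K u ω = inner ℝ ω u ^ 2 := by simp [truncSq, Set.indicator, h]
    rw [h4]
    nlinarith [sq_nonneg (inner ℝ ω u)]
  · have h4 : truncSq σ K u ω = 0 := by simp [truncSq, Set.indicator, h]
    rw [h4]
    linarith [Real.cos_le_one (inner ℝ ω u)]

theorem pow_three_le_mul_exp {y : ℝ} (hy : 0 ≤ y) : y ^ 3 ≤ 384 * Real.exp (y / 4) := by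
  have := Real.pow_div_factorial_le_exp (x := y / 4) (by positivity) 3
  norm_num [Nat.factorial] at this
  linarith

theorem integrable_truncSq (hσ : 0 < σ) {v : EuclideanSpace ℝ (Fin d)} (hv : ‖v‖ = σ) :
    Integrable (truncSq σ K v) (freqGaussian d σ) :=
  integrable_of_le_inner_sq hσ hv (measurable_truncSq v) (truncSq_nonneg v)
    fun ω => (truncSq_le v ω).trans (by linarith)

theorem integral_truncSq_le (hσ : 0 < σ) {v : EuclideanSpace ℝ (Fin d)} (hv : ‖v‖ = σ) :
    ∫ ω, truncSq σ K v ω ∂(freqGaussian d σ) ≤ 1 := by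
  rw [← integral_inner_sq hσ hv]
  exact integral_mono (integrable_truncSq hσ hv) (integrable_inner_sq hσ hv) (truncSq_le v)

/-- Truncation at level `K` loses only `O(K⁻²)` of the second moment. -/
theorem le_integral_truncSq (hσ : 0 < σ) (hd : 1 ≤ d) (hK : 0 < K)
    {v : EuclideanSpace ℝ (Fin d)} (hv : ‖v‖ = σ) :
    1 - 1250 / K ^ 2 ≤ ∫ ω, truncSq σ K v ω ∂(freqGaussian d σ) := by
  have hpt : ∀ ω : EuclideanSpace ℝ (Fin d), inner ℝ ω v ^ 2 - truncSq σ K v ω ≤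
      384 / K ^ 2 * (Real.exp (inner ℝ ω v ^ 2 / 4) +
        Real.exp (σ ^ 2 * ‖ω‖ ^ 2 / d / 4)) := by
    intro ω
    by_cases h : σ ^ 2 * ‖ω‖ ^ 2 / d ≤ K
    · have h4 : truncSq σ K v ω = inner ℝ ω v ^ 2 := by simp [truncSq, Set.indicator, h]
      rw [h4, sub_self]
      positivity
    · have h4 : truncSq σ K v ω = 0 := by simp [truncSq, Set.indicator, h]
      rw [h4, sub_zero]
      have hz : 0 ≤ inner ℝ ω v ^ 2 := sq_nonneg _
      have hy : 0 ≤ σ ^ 2 * ‖ω‖ ^ 2 / d := by positivity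
      generalize inner ℝ ω v ^ 2 = z at *
      generalize σ ^ 2 * ‖ω‖ ^ 2 / d = y at *
      rw [not_le] at h
      have h1 := pow_three_le_mul_exp hz
      have h2 := pow_three_le_mul_exp hy
      -- Young's inequality `z y² ≤ z³ + y³`.
      have h3 : z * y ^ 2 ≤ z ^ 3 + y ^ 3 := by
        rcases le_total z y with hzy | hzy
        · nlinarith [mul_le_mul_of_nonneg_right hzy (sq_nonneg y), pow_nonneg hz 3]
        · nlinarith [mul_le_mul_of_nonneg_left (pow_le_pow_left₀ hy hzy 2) hz, pow_nonneg hy 3]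
      have h5 : z * K ^ 2 ≤ z * y ^ 2 :=
        mul_le_mul_of_nonneg_left (pow_le_pow_left₀ hK.le h.le 2) hz
      rw [div_mul_eq_mul_div, le_div_iff₀ (by positivity)]
      linarith
  have i1 := integrable_inner_sq hσ hv
  have i2 := integrable_truncSq (K := K) hσ hv
  have i3 := integrable_exp_inner_sq hσ hv
  have i4 := integrable_exp_normSq hσ hd
  have h := integral_mono (i1.sub i2) ((i3.add i4).const_mul (384 / K ^ 2)) hpt
  simp only [Pi.sub_apply, Pi.add_apply] at h
  rw [integral_sub i1 i2, integral_inner_sq hσ hv, integral_const_mul, integral_add i3 i4,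
    integral_exp_inner_sq hσ hv] at h
  have h2 := integral_exp_normSq_le hσ hd
  have h3 : Real.sqrt 2 ≤ 1.6 := by
    rw [Real.sqrt_le_left (by norm_num)]; norm_num
  have h4 : 384 / K ^ 2 * (Real.sqrt 2 +
      ∫ ω, Real.exp (σ ^ 2 * ‖ω‖ ^ 2 / d / 4) ∂(freqGaussian d σ)) ≤ 1250 / K ^ 2 := by
    rw [div_mul_eq_mul_div]
    gcongr
    linarith
  linarith

theorem sum_truncSq (hm : 0 < m) (v : EuclideanSpace ℝ (Fin d))
    (w : Fin m → EuclideanSpace ℝ (Fin d)) :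
    ∑ j, truncSq σ K v (w j) / freqWeight σ (w j) ^ 2 = m * empiricalTruncSq σ K w v := by
  have hm0 : (m : ℝ) ≠ 0 := by positivity
  rw [empiricalTruncSq, ← mul_assoc, mul_one_div_cancel hm0, one_mul]

/-- With the truncation level `100 / √t`, the bias is at most `t / 8`. -/
theorem freqLaw_empiricalTruncSq (hσ : 0 < σ) (hd : 1 ≤ d) (hm : 0 < m) (ht0 : 0 < t)
    (ht1 : t < 1) {v : EuclideanSpace ℝ (Fin d)} (hv : ‖v‖ = σ) :
    freqLaw d m σ {w | 3 / 8 * t < |empiricalTruncSq σ (100 / Real.sqrt t) w v - 1|} ≤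
      ENNReal.ofReal (2 * Real.exp (-(m * t ^ 2 / 57600))) := by
  set K := 100 / Real.sqrt t with hKdef
  have hs1 : 0 < Real.sqrt t := Real.sqrt_pos.2 ht0
  have hK : 0 < K := by positivity
  have hbias : 1250 / K ^ 2 = t / 8 := by
    rw [hKdef, div_pow, Real.sq_sqrt ht0.le]
    field_simp
    norm_num
  have h1 := integral_truncSq_le (K := K) hσ hv
  have h2 := le_integral_truncSq hσ hd hK hv
  have hv2 := fun ω => (truncSq_le (σ := σ) (K := K) v ω).trans
    (by linarith : inner ℝ ω v ^ 2 ≤ inner ℝ ω v ^ 2 + 2)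
  have hup := freqLaw_upper_tail hσ hd hv (measurable_truncSq v) (truncSq_nonneg (K := K) v) hv2
    (τ := t / 4) (by positivity) (by linarith) m
  have hlow := freqLaw_lower_tail hσ hd hv (measurable_truncSq v) (truncSq_nonneg (K := K) v) hv2
    (τ := t / 4) (by positivity) (by linarith) m
  have hexp : (m : ℝ) * (t / 4) ^ 2 / 3600 = m * t ^ 2 / 57600 := by ring
  rw [hexp] at hup hlow
  rw [two_mul, ENNReal.ofReal_add (Real.exp_pos _).le (Real.exp_pos _).le]
  refine le_trans (measure_mono ?_) ((measure_union_le _ _).trans (add_le_add hup hlow))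
  intro w hw
  rw [Set.mem_ofPred_eq, lt_abs] at hw
  have hm0 : (0 : ℝ) < m := by positivity
  rcases hw with hw | hw
  · left
    rw [Set.mem_ofPred_eq, sum_truncSq hm]
    gcongr
    linarith
  · right
    rw [Set.mem_ofPred_eq, sum_truncSq hm]
    gcongr
    linarith

/-- Control on a `1 / 4`-net of the unit sphere of `T` gives control on the whole sphere. -/
theorem abs_empiricalTruncSq_sub_one_le (w : Fin m → EuclideanSpace ℝ (Fin d)) {η : ℝ}
    (T : Submodule ℝ (EuclideanSpace ℝ (Fin d))) (F : Finset (EuclideanSpace ℝ (Fin d)))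
    (hFT : ∀ n ∈ F, n ∈ T) (hF1 : ∀ n ∈ F, ‖n‖ = 1)
    (hnet : ∀ v ∈ T, ‖v‖ = 1 → ∃ n ∈ F, ‖v - n‖ ≤ 1 / 4)
    (hη : ∀ n ∈ F, |empiricalTruncSq σ K w (σ • n) - 1| ≤ η)
    {v : EuclideanSpace ℝ (Fin d)} (hv : v ∈ T) (hv1 : ‖v‖ = 1) :
    |empiricalTruncSq σ K w (σ • v) - 1| ≤ 2 * η := by
  let c : Fin m → ℝ := fun j =>
    1 / m * (Set.indicator {ω | σ ^ 2 * ‖ω‖ ^ 2 / d ≤ K} (fun _ => 1) (w j) /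
      freqWeight σ (w j) ^ 2)
  let φ : Fin m → EuclideanSpace ℝ (Fin d) →ₗ[ℝ] ℝ := fun j =>
    (innerₗ (EuclideanSpace ℝ (Fin d))) (σ • w j)
  let B : LinearMap.BilinForm ℝ (EuclideanSpace ℝ (Fin d)) :=
    ∑ j, c j • LinearMap.BilinForm.linMulLin (φ j) (φ j) - innerₗ (EuclideanSpace ℝ (Fin d))
  have hBapp : ∀ a b, B a b = ∑ j, c j * (φ j a * φ j b) - inner ℝ a b := fun a b => by
    simp [B, LinearMap.sum_apply]
  have hdiag : ∀ a, ‖a‖ = 1 → B a a = empiricalTruncSq σ K w (σ • a) - 1 := by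
    intro a ha
    rw [hBapp, real_inner_self_eq_norm_sq, ha, one_pow, empiricalTruncSq, Finset.mul_sum]
    congr 1
    refine Finset.sum_congr rfl fun j _ => ?_
    by_cases h : σ ^ 2 * ‖w j‖ ^ 2 / d ≤ K
    · simp [c, φ, truncSq, Set.indicator, h, inner_smul_right]
      ring
    · simp [c, truncSq, Set.indicator, h]
  rw [← hdiag v hv1]
  refine B.abs_le_of_net (fun a b => ?_) T F hFT hF1 hnet (fun n hn => ?_) hv hv1
  · rw [hBapp, hBapp, real_inner_comm]
    simp only [mul_comm (φ _ b)]
  · rw [hdiag n (hF1 n hn)]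
    exact hη n hn

/-- Near the origin, the quadratic form controls the empirical metric from below. -/
theorem sqKernelMetric_le_of_empiricalTruncSq (hσ : 0 < σ) (hd : 1 ≤ d) (ht0 : 0 < t)
    (ht1 : t < 1) (w : Fin m → EuclideanSpace ℝ (Fin d)) {u : EuclideanSpace ℝ (Fin d)}
    (hu0 : u ≠ 0) (hu : ‖u‖ ^ 2 / σ ^ 2 ≤ t * Real.sqrt t / (400 * d))
    (hQ : |empiricalTruncSq σ (100 / Real.sqrt t) w (σ • (‖u‖⁻¹ • u)) - 1| ≤ 2 * (3 / 8 * t)) :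
    (1 - t) * sqKernelMetric σ u ≤ empiricalSqMetric σ w u := by
  set K := 100 / Real.sqrt t with hKdef
  have hs1 : 0 < Real.sqrt t := Real.sqrt_pos.2 ht0
  have hd0 : (0 : ℝ) < d := by positivity
  have hn : 0 < ‖u‖ := norm_pos_iff.2 hu0
  have hrem : K * d * (‖u‖ ^ 2 / σ ^ 2) ≤ t / 4 := by
    calc K * d * (‖u‖ ^ 2 / σ ^ 2) ≤ K * d * (t * Real.sqrt t / (400 * d)) := by gcongr
      _ = t / 4 := by rw [hKdef]; field_simp; norm_num
  have hlow : (1 - t / 4) * empiricalTruncSq σ K w u ≤ empiricalSqMetric σ w u := by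
    rw [empiricalTruncSq, empiricalSqMetric, mul_left_comm, Finset.mul_sum]
    gcongr with j
    rw [← mul_div_assoc]
    have h1 := mul_truncSq_le_two_mul_one_sub_cos (K := K) hσ hd u (w j)
    have h2 := truncSq_nonneg (σ := σ) (K := K) u (w j)
    exact div_le_div_of_nonneg_right
      ((mul_le_mul_of_nonneg_right (by linarith) h2).trans h1) (sq_nonneg _)
  have hscale : empiricalTruncSq σ K w u =
      ‖u‖ ^ 2 / σ ^ 2 * empiricalTruncSq σ K w (σ • (‖u‖⁻¹ • u)) := by
    simp only [empiricalTruncSq, truncSq_smul, Finset.mul_sum]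
    refine Finset.sum_congr rfl fun j _ => ?_
    field_simp
  have hQ1 := (abs_le.1 hQ).1
  have hle := sqKernelMetric_le (σ := σ) u
  have ha : 0 ≤ ‖u‖ ^ 2 / σ ^ 2 := by positivity
  rw [hscale] at hlow
  generalize ‖u‖ ^ 2 / σ ^ 2 = a at *
  generalize empiricalTruncSq σ K w (σ • (‖u‖⁻¹ • u)) = q at *
  have h1 : (1 - t) * sqKernelMetric σ u ≤ (1 - t) * a :=
    mul_le_mul_of_nonneg_left hle (by linarith)
  have h2 : (1 - t) ≤ (1 - t / 4) * q := by
    have : (1 - t / 4) * (1 - 3 / 4 * t) ≤ (1 - t / 4) * q :=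
      mul_le_mul_of_nonneg_left (by linarith) (by linarith)
    nlinarith [sq_nonneg t]
  nlinarith [mul_le_mul_of_nonneg_left h2 ha]

end Truncation

/-! ### Uniform lower bound on a subspace -/

section Uniform

variable {d m : ℕ} {σ M t : ℝ}

/-- If the ball of radius `2 M` leaves the small regime, then `d / t` is bounded by a power of
`M d / (σ t)`, so the covering number of the ball has base a power of the latter. -/
theorem one_add_div_le_pow (hσ : 0 < σ) (hd : 1 ≤ d) (hM : 0 < M) (ht0 : 0 < t)
    (h : t * Real.sqrt t / (400 * d) ≤ (2 * M) ^ 2 / σ ^ 2) :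
    1 + 2 * (2 * M) / (σ * t ^ 3 / (9600 * d ^ 2)) ≤ max 2 (M * d / (σ * t)) ^ 70 := by
  have hd1 : (1 : ℝ) ≤ d := by exact_mod_cast hd
  have hd0 : (0 : ℝ) < d := by positivity
  set p := M * d / (σ * t) with hp
  set q := max 2 p
  have hp0 : 0 < p := by positivity
  have hpq : p ≤ q := le_max_right _ _
  have hq : 2 ≤ q := le_max_left _ _
  have hbase : 2 * (2 * M) / (σ * t ^ 3 / (9600 * d ^ 2)) = 38400 * (p * (d / t ^ 2)) := by
    rw [hp]; field_simp; norm_num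
  have h1 : d * (t * Real.sqrt t) ≤ 1600 * p ^ 2 * t ^ 2 := by
    have : (2 * M) ^ 2 / σ ^ 2 = 4 * p ^ 2 * t ^ 2 / d ^ 2 := by
      rw [hp]; field_simp; norm_num
    rw [this, div_le_div_iff₀ (by positivity) (by positivity)] at h
    refine le_of_mul_le_mul_right ?_ hd0
    linarith
  have h2 : (d : ℝ) ^ 2 / t ≤ (1600 * p ^ 2) ^ 2 := by
    have h3 := pow_le_pow_left₀ (by positivity) h1 2
    have h4 : (d * (t * Real.sqrt t)) ^ 2 = d ^ 2 * t ^ 3 := by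
      rw [mul_pow, mul_pow, Real.sq_sqrt ht0.le]; ring
    rw [h4] at h3
    rw [div_le_iff₀ ht0]
    refine le_of_mul_le_mul_right ?_ (by positivity : 0 < t ^ 3)
    linarith
  have h5 : d / t ^ 2 ≤ (1600 * p ^ 2) ^ 4 := by
    calc d / t ^ 2 ≤ (d ^ 2 / t) ^ 2 := by
          rw [div_pow]
          gcongr
          rw [← pow_mul]
          exact le_self_pow₀ hd1 (by norm_num)
      _ ≤ ((1600 * p ^ 2) ^ 2) ^ 2 := by gcongr
      _ = _ := by ring
  have hq0 : 0 < q := by linarith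
  have h6 : 38400 * (p * (d / t ^ 2)) ≤ q ^ 69 := by
    calc 38400 * (p * (d / t ^ 2)) ≤ 38400 * (q * (1600 * q ^ 2) ^ 4) := by
          gcongr
          exact h5.trans (by gcongr)
      _ = 38400 * 1600 ^ 4 * q ^ 9 := by ring
      _ ≤ 2 ^ 60 * q ^ 9 := by gcongr; norm_num
      _ ≤ q ^ 60 * q ^ 9 := by gcongr
      _ = q ^ 69 := by ring
  have h7 : 1 ≤ q ^ 69 := one_le_pow₀ (by linarith)
  rw [hbase]
  calc 1 + 38400 * (p * (d / t ^ 2)) ≤ q ^ 69 * 2 := by linarith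
    _ ≤ q ^ 69 * q := by gcongr
    _ = q ^ 70 := by ring

theorem measure_biUnion_finset_le_card_mul {Ω ι : Type*} [MeasurableSpace Ω] (P : Measure Ω)
    (F : Finset ι) (A : ι → Set Ω) {c b : ℝ} (hc : 0 ≤ c) (hb : (F.card : ℝ) ≤ b)
    (hA : ∀ i ∈ F, P (A i) ≤ ENNReal.ofReal c) :
    P (⋃ i ∈ F, A i) ≤ ENNReal.ofReal (b * c) := by
  refine (measure_biUnion_finset_le F A).trans ((Finset.sum_le_sum hA).trans ?_)
  rw [Finset.sum_const, nsmul_eq_mul, ← ENNReal.ofReal_natCast,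
    ← ENNReal.ofReal_mul (by positivity)]
  exact ENNReal.ofReal_le_ofReal (mul_le_mul_of_nonneg_right hb hc)

open Module in
/-- Outside an event of small probability, the empirical metric dominates `1 - t` times the kernel
metric on the ball of radius `2 M` of a subspace `T`. Small vectors are handled by the truncated
quadratic form on a net of the unit sphere, the others by an `ε`-net of the ball. -/
theorem exists_exceptional_set (hσ : 0 < σ) (hd : 1 ≤ d) (hm : 0 < m) (hM : 0 < M) (ht0 : 0 < t)
    (ht1 : t < 1) (T : Submodule ℝ (EuclideanSpace ℝ (Fin d))) {k : ℕ} (hk : finrank ℝ T ≤ k) :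
    ∃ bad : Set (Fin m → EuclideanSpace ℝ (Fin d)),
      freqLaw d m σ bad ≤ ENNReal.ofReal
        ((2 * 9 ^ k + max 2 (M * d / (σ * t)) ^ (70 * k)) *
          Real.exp (-(m * t ^ 2 / 57600))) ∧
      ∀ w ∉ bad, ∀ u ∈ T, ‖u‖ ≤ 2 * M →
        (1 - t) * sqKernelMetric σ u ≤ empiricalSqMetric σ w u := by
  set q := max 2 (M * d / (σ * t))
  have hq : 2 ≤ q := le_max_left _ _
  have hd0 : (0 : ℝ) < d := by positivity
  set ε := σ * t ^ 3 / (9600 * d ^ 2) with hε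
  have hs1 : 0 < Real.sqrt t := Real.sqrt_pos.2 ht0
  set b := t * Real.sqrt t / (400 * d)
  have hb0 : 0 < b := by positivity
  obtain ⟨F, hFA, hFnet, hFcard⟩ := T.exists_finset_net (R := 1) (ε := 1 / 4) zero_le_one
    (by norm_num) {v | v ∈ T ∧ ‖v‖ = 1} (fun v hv => hv.1) (fun v hv => hv.2.le)
  obtain ⟨G, hGA, hGnet, hGcard⟩ := T.exists_finset_net (R := 2 * M) (ε := ε) (by positivity)
    (by positivity) {u | u ∈ T ∧ ‖u‖ ≤ 2 * M ∧ b ≤ ‖u‖ ^ 2 / σ ^ 2} (fun u hu => hu.1)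
    (fun u hu => hu.2.1)
  have hFk : (F.card : ℝ) ≤ 9 ^ k := by
    refine hFcard.trans ?_
    norm_num
    exact pow_le_pow_right₀ (by norm_num) hk
  have hGk : (G.card : ℝ) ≤ q ^ (70 * k) := by
    rcases G.eq_empty_or_nonempty with rfl | ⟨n, hn⟩
    · simp only [Finset.card_empty, Nat.cast_zero]
      positivity
    · obtain ⟨-, hn1, hn2⟩ := hGA n hn
      have hbase := one_add_div_le_pow hσ hd hM ht0 (hn2.trans (by gcongr))
      calc (G.card : ℝ) ≤ (1 + 2 * (2 * M) / ε) ^ finrank ℝ T := hGcard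
        _ ≤ (q ^ 70) ^ finrank ℝ T := by gcongr
        _ ≤ (q ^ 70) ^ k := pow_le_pow_right₀ (one_le_pow₀ (by linarith)) hk
        _ = q ^ (70 * k) := by rw [pow_mul]
  refine ⟨(⋃ n ∈ F, {w | 3 / 8 * t <
      |empiricalTruncSq σ (100 / Real.sqrt t) w (σ • n) - 1|}) ∪
    ⋃ n ∈ G, {w | empiricalSqMetric σ w n ≤ (1 - t / 2) * sqKernelMetric σ n}, ?_, ?_⟩
  · refine (measure_union_le _ _).trans ?_
    have h1 := measure_biUnion_finset_le_card_mul (freqLaw d m σ) F (fun n => {w | 3 / 8 * t <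
      |empiricalTruncSq σ (100 / Real.sqrt t) w (σ • n) - 1|}) (by positivity) hFk
      (fun n hn => freqLaw_empiricalTruncSq hσ hd hm ht0 ht1 (v := σ • n) (by
        rw [norm_smul, (hFA n hn).2, mul_one, Real.norm_of_nonneg hσ.le]))
    have h2 := measure_biUnion_finset_le_card_mul (freqLaw d m σ) G (fun n =>
      {w | empiricalSqMetric σ w n ≤ (1 - t / 2) * sqKernelMetric σ n})
      (c := Real.exp (-(m * t ^ 2 / 57600))) (by positivity) hGk (fun n hn => by
        have hn0 : n ≠ 0 := by
          rintro rfl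
          have := (hGA 0 hn).2.2
          simp at this
          linarith
        refine (freqLaw_empiricalSqMetric_le hσ hd hm hn0 (τ := t / 2) (by positivity)
          (by linarith)).trans (ENNReal.ofReal_le_ofReal (Real.exp_le_exp.2 ?_))
        have : 0 ≤ (m : ℝ) * t ^ 2 := by positivity
        linarith)
    refine (add_le_add h1 h2).trans_eq ?_
    rw [← ENNReal.ofReal_add (by positivity) (by positivity)]
    congr 1
    ring
  · intro w hw u huT huM
    simp only [Set.mem_union, Set.mem_iUnion, Set.mem_ofPred_eq, exists_prop, not_or, not_exists,
      not_and, not_lt, not_le] at hw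
    by_cases hu0 : u = 0
    · subst hu0
      simp [sqKernelMetric, empiricalSqMetric]
    rcases le_total (‖u‖ ^ 2 / σ ^ 2) b with hub | hub
    · refine sqKernelMetric_le_of_empiricalTruncSq hσ hd ht0 ht1 w hu0 hub ?_
      refine abs_empiricalTruncSq_sub_one_le w T F (fun n hn => (hFA n hn).1)
        (fun n hn => (hFA n hn).2) (fun v hv hv1 => hFnet v ⟨hv, hv1⟩) hw.1
        (T.smul_mem _ huT) ?_
      rw [norm_smul, norm_inv, norm_norm, inv_mul_cancel₀ (norm_ne_zero_iff.2 hu0)]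
    · obtain ⟨n, hn, hun⟩ := hGnet u ⟨huT, huM, hub⟩
      exact sqKernelMetric_le_of_near hσ hd ht0 ht1 w hub hun (hw.2 n hn).le

end Uniform

/-! ### The two properties -/

theorem ofReal_one_sub_le_measure {Ω : Type*} [MeasurableSpace Ω] (P : Measure Ω)
    [IsProbabilityMeasure P] {A B : Set Ω} {ρ : ℝ} (hρ : 0 ≤ ρ) (hB : P B ≤ ENNReal.ofReal ρ)
    (hAB : ∀ w ∉ B, w ∈ A) : ENNReal.ofReal (1 - ρ) ≤ P A := by
  rw [ENNReal.ofReal_sub _ hρ, ENNReal.ofReal_one, tsub_le_iff_right]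
  calc 1 = P Set.univ := measure_univ.symm
    _ ≤ P (A ∪ B) := measure_mono fun w _ => by
        by_cases hw : w ∈ B
        exacts [Or.inr hw, Or.inl (hAB w hw)]
    _ ≤ P A + P B := measure_union_le _ _
    _ ≤ P A + ENNReal.ofReal ρ := by gcongr

section Properties

variable {d m : ℕ} {σ t : ℝ}

theorem isProbabilityMeasure_freqLaw (hσ : 0 < σ) (hd : 1 ≤ d) :
    IsProbabilityMeasure (freqLaw d m σ) := by
  have := isProbabilityMeasure_freqMeasure hσ hd
  unfold freqLaw
  infer_instance

theorem gaussianKernelMetric_le_of_sq (ht0 : 0 < t) (ht1 : t < 1)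
    (w : Fin m → EuclideanSpace ℝ (Fin d)) (x x' : EuclideanSpace ℝ (Fin d))
    (h : (1 - t) * sqKernelMetric σ (x - x') ≤ empiricalSqMetric σ w (x - x')) :
    gaussianKernelMetric σ x x' ≤
      (1 - t)⁻¹ * ‖randomFourierMap σ w x - randomFourierMap σ w x'‖ + 0 := by
  rw [add_zero, inv_mul_eq_div, le_div_iff₀' (by linarith)]
  refine le_of_sq_le_sq ?_ (norm_nonneg _)
  rw [norm_sq_randomFourierMap_sub, mul_pow, gaussianKernelMetric_sq]
  have h0 := sqKernelMetric_nonneg (σ := σ) (x - x')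
  exact (mul_le_mul_of_nonneg_right (by nlinarith) h0).trans h

theorem norm_randomFourierMap_sub_le_of_sq (ht0 : 0 < t)
    (w : Fin m → EuclideanSpace ℝ (Fin d)) (x x' : EuclideanSpace ℝ (Fin d))
    (h : empiricalSqMetric σ w (x - x') ≤ (1 + t) * sqKernelMetric σ (x - x')) :
    ‖randomFourierMap σ w x - randomFourierMap σ w x'‖ ≤
      (1 + t) * gaussianKernelMetric σ x x' := by
  refine le_of_sq_le_sq ?_ (mul_nonneg (by linarith) (Real.sqrt_nonneg _))
  rw [norm_sq_randomFourierMap_sub, mul_pow, gaussianKernelMetric_sq]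
  have h0 := sqKernelMetric_nonneg (σ := σ) (x - x')
  exact h.trans (mul_le_mul_of_nonneg_right (by nlinarith) h0)

theorem boundednessProperty_randomFourierMap (hσ : 0 < σ) (hd : 1 ≤ d) (hm : 0 < m) (ht0 : 0 < t)
    (ht1 : t < 1) {ρ : ℝ} (hρ0 : 0 < ρ) (hρ : Real.exp (-(m * t ^ 2 / 3600)) ≤ ρ)
    (𝔖 : Set (EuclideanSpace ℝ (Fin d))) :
    BoundednessProperty (freqLaw d m σ) (randomFourierMap σ) 𝔖 (1 + t)
      (gaussianKernelMetric σ) ρ := by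
  intro x xS _
  have := isProbabilityMeasure_freqLaw (m := m) hσ hd
  by_cases hx : x = xS
  · subst hx
    refine ofReal_one_sub_le_measure _ hρ0.le (B := ∅) (by simp) fun w _ => ?_
    rw [Set.mem_ofPred_eq]
    exact norm_randomFourierMap_sub_le_of_sq ht0 w x x (by simp [empiricalSqMetric, sqKernelMetric])
  · refine ofReal_one_sub_le_measure _ hρ0.le
      ((freqLaw_empiricalSqMetric_ge hσ hd hm (sub_ne_zero.2 hx) ht0.le ht1.le).trans
        (ENNReal.ofReal_le_ofReal hρ)) fun w hw => ?_
    rw [Set.mem_ofPred_eq, not_le] at hw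
    exact norm_randomFourierMap_sub_le_of_sq ht0 w x xS hw.le

open Module in
theorem nonUniformLRIP_randomFourierMap (hσ : 0 < σ) (hd : 1 ≤ d) (hm : 0 < m) {M : ℝ}
    (hM : 0 < M) (ht0 : 0 < t) (ht1 : t < 1) {ρ : ℝ} (hρ0 : 0 < ρ) {N s : ℕ}
    (S : Fin N → Submodule ℝ (EuclideanSpace ℝ (Fin d))) (hS : ∀ i, finrank ℝ (S i) ≤ s)
    (hρ : N * ((2 * 9 ^ (s + 1) + max 2 (M * d / (σ * t)) ^ (70 * (s + 1))) *
      Real.exp (-(m * t ^ 2 / 57600))) ≤ ρ) :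
    NonUniformLRIP (freqLaw d m σ) (randomFourierMap σ) (unionOfSubspaces S M) (1 - t)⁻¹
      (gaussianKernelMetric σ) ρ 0 := by
  intro x hx
  have := isProbabilityMeasure_freqLaw (m := m) hσ hd
  have hdim : ∀ i, finrank ℝ ↥(S i ⊔ Submodule.span ℝ {x}) ≤ s + 1 := fun i =>
    (Submodule.finrank_add_le_finrank_add_finrank _ _).trans
      (add_le_add (hS i) ((finrank_span_le_card {x}).trans (by simp)))
  choose bad hbad hgood using fun i =>
    exists_exceptional_set hσ hd hm hM ht0 ht1 (S i ⊔ Submodule.span ℝ {x}) (hdim i)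
  have hmeas := measure_biUnion_finset_le_card_mul (freqLaw d m σ) Finset.univ bad
    (b := N) (by positivity) (by simp) fun i _ => hbad i
  have hball : ∀ y ∈ unionOfSubspaces S M, ‖y‖ ≤ M := by
    intro y hy
    obtain ⟨i, -, hi⟩ := Set.mem_iUnion.1 hy
    simpa using hi
  refine ofReal_one_sub_le_measure _ hρ0.le (hmeas.trans (ENNReal.ofReal_le_ofReal hρ))
    fun w hw x' hx' => ?_
  simp only [Finset.mem_univ, Set.iUnion_true, Set.mem_iUnion, not_exists] at hw
  obtain ⟨i, hi, -⟩ := Set.mem_iUnion.1 hx'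
  refine gaussianKernelMetric_le_of_sq ht0 ht1 w x x' (hgood i w (hw i) _ ?_ ?_)
  · exact Submodule.sub_mem _ (Submodule.mem_sup_right (Submodule.mem_span_singleton_self x))
      (Submodule.mem_sup_left hi)
  · linarith [norm_sub_le x x', hball x hx, hball x' hx']

/-- For zero-dimensional subspaces the model is the origin alone. -/
theorem nonUniformLRIP_of_finrank_eq_zero (hσ : 0 < σ) (hd : 1 ≤ d) {M α : ℝ}
    {ρ : ℝ} (hρ0 : 0 < ρ) {N : ℕ}
    (S : Fin N → Submodule ℝ (EuclideanSpace ℝ (Fin d)))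
    (hS : ∀ i, Module.finrank ℝ (S i) = 0) :
    NonUniformLRIP (freqLaw d m σ) (randomFourierMap σ) (unionOfSubspaces S M) α
      (gaussianKernelMetric σ) ρ 0 := by
  intro x hx
  have := isProbabilityMeasure_freqLaw (m := m) hσ hd
  have hzero : ∀ y ∈ unionOfSubspaces S M, y = 0 := by
    intro y hy
    obtain ⟨i, hi, -⟩ := Set.mem_iUnion.1 hy
    have h := Submodule.finrank_eq_zero.1 (hS i)
    simpa [h] using hi
  refine ofReal_one_sub_le_measure _ hρ0.le (B := ∅) (by simp) fun w _ x' hx' => ?_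
  rw [hzero x hx, hzero x' hx']
  simp [gaussianKernelMetric]

end Properties

/-- The union bound: the number of events, counted with the net sizes, is absorbed by the
condition on `m`. -/
theorem card_mul_exp_le {N s m : ℕ} {q t ρ : ℝ} (hN : 1 ≤ N) (hs : 1 ≤ s) (hq : 2 ≤ q)
    (ht : 0 < t) (hρ0 : 0 < ρ) (hρ1 : ρ ≤ 1)
    (hm : 57600 * 141 * (t ^ 2)⁻¹ * (s * Real.log q + Real.log N + Real.log (1 / ρ)) ≤ m) :
    N * ((2 * 9 ^ (s + 1) + q ^ (70 * (s + 1))) * Real.exp (-(m * t ^ 2 / 57600))) ≤ ρ := by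
  have hq0 : 0 < q := by linarith
  have hq1 : 1 ≤ q := by linarith
  have hN0 : (0 : ℝ) < N := by positivity
  have hcount : 2 * 9 ^ (s + 1) + q ^ (70 * (s + 1)) ≤ q ^ (141 * s) := by
    have h9 : (9 : ℝ) ≤ q ^ 4 := le_trans (by norm_num) (pow_le_pow_left₀ zero_le_two hq 4)
    have h1 : 2 * 9 ^ (s + 1) ≤ q ^ (140 * s) := by
      calc 2 * 9 ^ (s + 1) ≤ q * (q ^ 4) ^ (s + 1) := by gcongr
        _ = q ^ (1 + 4 * (s + 1)) := by rw [← pow_mul, pow_add, pow_one]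
        _ ≤ q ^ (140 * s) := pow_le_pow_right₀ hq1 (by omega)
    have h2 : q ^ (70 * (s + 1)) ≤ q ^ (140 * s) := pow_le_pow_right₀ hq1 (by omega)
    calc 2 * 9 ^ (s + 1) + q ^ (70 * (s + 1)) ≤ 2 * q ^ (140 * s) := by linarith
      _ ≤ q * q ^ (140 * s) := by gcongr
      _ = q ^ (1 + 140 * s) := by rw [pow_add, pow_one]
      _ ≤ q ^ (141 * s) := pow_le_pow_right₀ hq1 (by omega)
  have hpow : q ^ (141 * s) = Real.exp (141 * (s * Real.log q)) := by
    rw [← Real.exp_log (pow_pos hq0 _), Real.log_pow]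
    push_cast
    ring_nf
  have hL : 0 ≤ s * Real.log q := mul_nonneg (Nat.cast_nonneg s) (Real.log_nonneg hq1)
  have hLN : 0 ≤ Real.log N := Real.log_natCast_nonneg N
  have hLρ : 0 ≤ Real.log (1 / ρ) := Real.log_nonneg (by rw [le_div_iff₀ hρ0]; linarith)
  have hm' : 141 * (s * Real.log q + Real.log N + Real.log (1 / ρ)) ≤ m * t ^ 2 / 57600 := by
    have ht2 : 0 < t ^ 2 := by positivity
    rw [mul_right_comm, ← div_eq_mul_inv, div_le_iff₀ ht2] at hm
    linarith
  calc N * ((2 * 9 ^ (s + 1) + q ^ (70 * (s + 1))) * Real.exp (-(m * t ^ 2 / 57600)))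
      ≤ N * (q ^ (141 * s) * Real.exp (-(m * t ^ 2 / 57600))) := by gcongr
    _ = Real.exp (Real.log N + (141 * (s * Real.log q) + -(m * t ^ 2 / 57600))) := by
        rw [hpow, Real.exp_add, Real.exp_add, Real.exp_log hN0]
    _ ≤ Real.exp (-Real.log (1 / ρ)) := Real.exp_le_exp.2 (by linarith)
    _ = ρ := by rw [one_div, Real.log_inv, neg_neg, Real.exp_log hρ0]

theorem proposition3 :
    ∃ C : ℝ, 0 < C ∧
      ∀ (d s N m : ℕ) (σ M t ρ : ℝ) (S : Fin N → Submodule ℝ (EuclideanSpace ℝ (Fin d))),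
        1 ≤ d → 1 ≤ N → 0 < σ → 0 < M → 0 < t → t < 1 → 0 < ρ → ρ ≤ 1 →
        (∀ i, Module.finrank ℝ (S i) = s) →
        C * (t ^ 2)⁻¹ *
            ((s : ℝ) * Real.log (max 2 (M * (d : ℝ) / (σ * t))) + Real.log (N : ℝ)
              + Real.log (1 / ρ)) ≤ (m : ℝ) →
        NonUniformLRIP (freqLaw d m σ) (randomFourierMap σ) (unionOfSubspaces S M)
            (1 - t)⁻¹ (gaussianKernelMetric σ) ρ 0 ∧
          BoundednessProperty (freqLaw d m σ) (randomFourierMap σ) (unionOfSubspaces S M)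
            (1 + t) (gaussianKernelMetric σ) ρ := by
  refine ⟨57600 * 141, by norm_num, ?_⟩
  intro d s N m σ M t ρ S hd hN hσ hM ht0 ht1 hρ0 hρ1 hS hm
  rcases hρ1.eq_or_lt with rfl | hρ1'
  · -- Probability `1 - ρ = 0` asks for nothing; this is the only case in which `m` may vanish.
    constructor
    · intro x _; simp
    · intro x xS _; simp
  have hq : 2 ≤ max 2 (M * (d : ℝ) / (σ * t)) := le_max_left _ _
  have hL : 0 ≤ s * Real.log (max 2 (M * (d : ℝ) / (σ * t))) :=
    mul_nonneg (Nat.cast_nonneg s) (Real.log_nonneg (by linarith))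
  have hLN : 0 ≤ Real.log N := Real.log_natCast_nonneg N
  have hLρ : 0 < Real.log (1 / ρ) := Real.log_pos (by rw [lt_div_iff₀ hρ0]; linarith)
  have hm0 : 0 < m := by
    have : (0 : ℝ) < m := lt_of_lt_of_le (by positivity) hm
    exact_mod_cast this
  constructor
  · rcases Nat.eq_zero_or_pos s with rfl | hs
    · exact nonUniformLRIP_of_finrank_eq_zero hσ hd hρ0 S hS
    · exact nonUniformLRIP_randomFourierMap hσ hd hm0 hM ht0 ht1 hρ0 S (fun i => (hS i).le)
        (card_mul_exp_le hN hs hq ht0 hρ0 hρ1 hm)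
  · refine boundednessProperty_randomFourierMap hσ hd hm0 ht0 ht1 hρ0 ?_ _
    have ht2 : 0 < t ^ 2 := by positivity
    rw [mul_right_comm, ← div_eq_mul_inv, div_le_iff₀ ht2] at hm
    calc Real.exp (-(m * t ^ 2 / 3600)) ≤ Real.exp (-Real.log (1 / ρ)) :=
          Real.exp_le_exp.2 (by linarith)
      _ = ρ := by rw [one_div, Real.log_inv, neg_neg, Real.exp_log hρ0]
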